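/- Conventions. A \emph{topos} is a Grothendieck topos, i.e. a category equivalent to the category of sheaves of sets on a small site. A geometric morphism $f:\mathcal E\to\mathcal F$ is an adjunction $f^*\dashv f_*$ with $f_*:\mathcal E\to\mathcal F$ and $f^*$ preserving finite limits. $\mathsf{Topoi}$ is the 2-category of topoi and geometric morphisms, where a 2-cell $f\Rightarrow g$ is a natural transformation $f^*\Rightarrow g^*$. A topos $\mathcal X$ is \emph{grouplike} if the category $\mathsf{Topoi}(\mathcal E,\mathcal X)$ is a groupoid for every topos $\mathcal E$. A geometric morphism $f:\mathcal Y\to\mathcal X$ is \emph{étale} if, for some object $A$ of $\mathcal X$, it is equivalent over $\mathcal X$ to the projection $\mathcal X/A\to\mathcal X$ from the slice topos, whose inverse image is $B\mapsto (A\times B\to A)$; it is a \emph{surjection} if $f^*$ is faithful. A \emph{coproduct} in $\mathsf{Topoi}$ of a small family of topoi $(\mathcal X_i)_{i\in I}$ is a topos $\mathcal P$ with geometric morphisms $\iota_i:\mathcal X_i\to\mathcal P$ such that, for every topos $\mathcal E$, the functor $\mathsf{Topoi}(\mathcal P,\mathcal E)\to\prod_{i\in I}\mathsf{Topoi}(\mathcal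 X_i,\mathcal E)$, $g\mapsto (g\circ\iota_i)_i$, is an equivalence of categories. Then: \begin{enumerate} \item If $\mathcal Y\to\mathcal X$ is an étale surjection of topoi and $\mathcal Y$ is grouplike, then $\mathcal X$ is grouplike. \item If $(\mathcal X_i)_{i\in I}$ is a small family of grouplike topoi, then the coproduct $\coprod_{i\in I}\mathcal X_i$ exists in $\mathsf{Topoi}$ and every such coproduct is grouplike. \item For every small groupoid $\mathcal G$, the presheaf topos $[\mathcal G,\mathsf{Set}]$ is grouplike. \end{enumerate} -/

import Mathlib

open CategoryTheory CategoryTheory.Limits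

universe u

/-- A category is a Grothendieck topos (relative to the universe `u`) if it is equivalent to the
category of sheaves of sets on a small site. -/
class IsGrothendieckTopos (E : Type (u + 1)) [LargeCategory.{u} E] : Prop where
  exists_site : ∃ (C : Type u) (_ : SmallCategory C) (J : GrothendieckTopology C),
    Nonempty (E ≌ Sheaf J (Type u))

instance IsGrothendieckTopos.hasFiniteLimits (E : Type (u + 1)) [LargeCategory.{u} E]
    [h : IsGrothendieckTopos E] : HasFiniteLimits E := by
  obtain ⟨C, _, J, ⟨e⟩⟩ := h.exists_site
  exact ⟨fun _ _ _ => Adjunction.hasLimitsOfShape_of_equivalence e.functor⟩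

/-- A geometric morphism `f : E → F`: an adjunction `f^* ⊣ f_*` with `f_* : E ⥤ F` and with
`f^* : F ⥤ E` preserving finite limits. -/
structure GeometricMorphism (E F : Type (u + 1)) [LargeCategory.{u} E] [LargeCategory.{u} F] where
  inverseImage : F ⥤ E
  directImage : E ⥤ F
  adj : inverseImage ⊣ directImage
  preservesFiniteLimits : PreservesFiniteLimits inverseImage

namespace GeometricMorphism

attribute [instance] GeometricMorphism.preservesFiniteLimits

section

variable {E F G : Type (u + 1)} [LargeCategory.{u} E] [LargeCategory.{u} F] [LargeCategory.{u} G]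

/-- A 2-cell `f ⟶ g` is a natural transformation `f^* ⟶ g^*` between inverse images. -/
@[ext]
structure Hom (f g : GeometricMorphism E F) where
  natTrans : f.inverseImage ⟶ g.inverseImage

/-- The hom-category `Topoi(E, F)`. -/
@[simps id_natTrans comp_natTrans]
instance homCategory : Category.{u + 1} (GeometricMorphism E F) where
  Hom f g := Hom f g
  id f := ⟨𝟙 f.inverseImage⟩
  comp α β := ⟨α.natTrans ≫ β.natTrans⟩

/-- The composite `E → F → G` of geometric morphisms. -/
def comp (f : GeometricMorphism E F) (g : GeometricMorphism F G) : GeometricMorphism E G where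
  inverseImage := g.inverseImage ⋙ f.inverseImage
  directImage := f.directImage ⋙ g.directImage
  adj := g.adj.comp f.adj
  preservesFiniteLimits := comp_preservesFiniteLimits _ _

/-- Precomposition with `f : E → F`, as a functor `Topoi(F, G) ⥤ Topoi(E, G)`. -/
def precomp (f : GeometricMorphism E F) (G : Type (u + 1)) [LargeCategory.{u} G] :
    GeometricMorphism F G ⥤ GeometricMorphism E G where
  obj g := f.comp g
  map α := ⟨Functor.whiskerRight α.natTrans f.inverseImage⟩
  map_id _ := Hom.ext (Functor.whiskerRight_id' f.inverseImage)
  map_comp α β := Hom.ext (Functor.whiskerRight_comp α.natTrans β.natTrans f.inverseImage)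

/-- A geometric morphism is a surjection if its inverse image functor is faithful. -/
def IsSurjection (f : GeometricMorphism E F) : Prop :=
  f.inverseImage.Faithful

/-- `f : E → F` is étale if it is equivalent, over `F`, to the projection `F/A → F` from the slice
over some object `A`, whose inverse image is `Over.star A : B ↦ (A ⨯ B ⟶ A)`. (Direct images are
determined by inverse images, up to a unique isomorphism.) -/
def IsEtale [HasBinaryProducts F] (f : GeometricMorphism E F) : Prop :=
  ∃ (A : F) (e : Over A ≌ E), Nonempty (f.inverseImage ≅ Over.star A ⋙ e.functor)

end

/-- A family `inj i : X i → P` of geometric morphisms exhibits `P` as a coproduct of the topoi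
`X i` in the 2-category of topoi: for every topos `E`, restriction along the `inj i` is an
equivalence `Topoi(P, E) ≌ ∏ i, Topoi(X i, E)`. -/
def IsCoproduct {I : Type u} {X : I → Type (u + 1)} [∀ i, LargeCategory.{u} (X i)]
    {P : Type (u + 1)} [LargeCategory.{u} P] (inj : ∀ i, GeometricMorphism (X i) P) : Prop :=
  ∀ (E : Type (u + 1)) [LargeCategory.{u} E] [IsGrothendieckTopos E],
    (Functor.pi' fun i => (inj i).precomp E).IsEquivalence

end GeometricMorphism

/-- A topos `X` is grouplike if `Topoi(E, X)` is a groupoid for every topos `E`. -/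
structure IsGrouplike (X : Type (u + 1)) [LargeCategory.{u} X] : Prop where
  isGrothendieckTopos : IsGrothendieckTopos X
  isGroupoid : ∀ (E : Type (u + 1)) [LargeCategory.{u} E] [IsGrothendieckTopos E],
    IsGroupoid (GeometricMorphism E X)

/-! Everything comes down to showing that a 2-cell `α : g ⟶ k` between geometric morphisms from `E`
to `X` is invertible at each object `F`. This can be checked locally on `E`: if objects `U i`
jointly cover the terminal object, a morphism is invertible once composing with it is bijective on
maps out of every `T` that admits a map to some `U i` (`JointlyCovers.isIso`). Inverse images
preserve such covers (`JointlyCovers.inverseImage`).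

Étale descent: if the slices `X/A i` jointly cover `X`, then the `A i` cover the terminal object,
hence so do the objects `g^* (A i)`. Localizing at `g^* A` makes a global section `s` of it appear
(`IsGrothendieckTopos.exists_globalSection`). Such a section lifts `g` through `X/A`, by sending `B`
over `A` to the fiber of `g^* B` over `s`; its image under `α` lifts `k`, and `α` induces a 2-cell
between the lifts. That 2-cell is invertible when `X/A` is grouplike, and at the object `A ⨯ F` over
`A` it is `α` at `F` (`isIso_natTrans_of_globalSection`).

Coproducts: the coproduct of topoi is the product of the categories. Its injections are étale, given
by slicing over the family that is terminal at `i` and initial elsewhere, and evaluations are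
jointly faithful, so descent applies. Any other coproduct is a retract of this one.

Groupoids: the corepresentable functors cover, and over the one at `x` every functor `F` becomes
constant with value `F x`. A 2-cell is invertible at constant objects because these are coproducts
of the terminal object. -/

open Opposite

/-! ### Elementwise calculus of sheaves of sets. -/

namespace SheafOfTypes

variable {C : Type u} [SmallCategory C] {K : GrothendieckTopology C}

theorem isSheaf_of_glue {P : Cᵒᵖ ⥤ Type u}
    (sep : ∀ {c : C} {S : Sieve c}, S ∈ K c → ∀ a b : P.obj (op c),
      (∀ ⦃d : C⦄ (f : d ⟶ c), S f → P.map f.op a = P.map f.op b) → a = b)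
    (glue : ∀ {c : C} {S : Sieve c}, S ∈ K c →
      ∀ x : (∀ ⦃d : C⦄ (f : d ⟶ c), S f → P.obj (op d)),
      (∀ ⦃d e : C⦄ (f : d ⟶ c) (g : e ⟶ d) (hf : S f),
        P.map g.op (x f hf) = x (g ≫ f) (S.downward_closed hf g)) →
      ∃ t : P.obj (op c), ∀ ⦃d : C⦄ (f : d ⟶ c) (hf : S f), P.map f.op t = x f hf) :
    Presheaf.IsSheaf K P := by
  rw [isSheaf_iff_isSheaf_of_type]
  intro c S hS x hx
  rw [Presieve.compatible_iff_sieveCompatible] at hx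
  obtain ⟨t, ht⟩ := glue hS (fun d f hf => x f hf) (fun d e f g hf => (hx f g hf).symm)
  refine ⟨t, fun d f hf => ht f hf, fun t' ht' => sep hS _ _ fun d f hf => ?_⟩
  rw [ht f hf]
  exact ht' f hf

theorem separated (F : Sheaf K (Type u)) {c : C} {S : Sieve c} (hS : S ∈ K c)
    {a b : F.obj.obj (op c)}
    (h : ∀ ⦃d : C⦄ (f : d ⟶ c), S f → F.obj.map f.op a = F.obj.map f.op b) : a = b :=
  (((isSheaf_iff_isSheaf_of_type K F.obj).1 F.property).isSeparated S hS).ext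
    fun _ f hf => h f hf

theorem exists_glue (F : Sheaf K (Type u)) {c : C} {S : Sieve c} (hS : S ∈ K c)
    (x : ∀ ⦃d : C⦄ (f : d ⟶ c), S f → F.obj.obj (op d))
    (hx : ∀ ⦃d e : C⦄ (f : d ⟶ c) (g : e ⟶ d) (hf : S f),
      F.obj.map g.op (x f hf) = x (g ≫ f) (S.downward_closed hf g)) :
    ∃ t : F.obj.obj (op c), ∀ ⦃d : C⦄ (f : d ⟶ c) (hf : S f), F.obj.map f.op t = x f hf := by
  have h : Presieve.FamilyOfElements.Compatible (P := F.obj) (R := S.arrows)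
      (fun d f hf => x f hf) :=
    (Presieve.compatible_iff_sieveCompatible _).2 fun d e f g hf => (hx f g hf).symm
  obtain ⟨t, ht, -⟩ := (isSheaf_iff_isSheaf_of_type K F.obj).1 F.property S hS _ h
  exact ⟨t, fun d f hf => ht f hf⟩

theorem hom_naturality {F G : Sheaf K (Type u)} (m : F ⟶ G) {c d : C} (f : d ⟶ c)
    (x : F.obj.obj (op c)) :
    m.hom.app (op d) (F.obj.map f.op x) = G.obj.map f.op (m.hom.app (op c) x) :=
  NatTrans.naturality_apply m.hom f.op x

theorem map_map (P : Cᵒᵖ ⥤ Type u) {c d e : C} (f : d ⟶ c) (g : e ⟶ d) (x : P.obj (op c)) :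
    P.map g.op (P.map f.op x) = P.map (g ≫ f).op x := by
  simp

theorem hom_ext {F G : Sheaf K (Type u)} {m n : F ⟶ G}
    (h : ∀ c (x : F.obj.obj (op c)), m.hom.app (op c) x = n.hom.app (op c) x) : m = n := by
  apply ObjectProperty.hom_ext
  ext ⟨c⟩ x
  exact h c x

/-- A morphism of sheaves given by a natural family of functions. -/
def mkHom {F G : Sheaf K (Type u)} (m : ∀ c, F.obj.obj (op c) → G.obj.obj (op c))
    (hm : ∀ {c d : C} (f : d ⟶ c) (x : F.obj.obj (op c)),
      m d (F.obj.map f.op x) = G.obj.map f.op (m c x)) : F ⟶ G :=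
  ⟨{ app := fun c => ↾(m c.unop)
     naturality := by
      rintro ⟨c⟩ ⟨d⟩ f
      ext x
      exact hm f.unop x }⟩

theorem comp_app {F G H : Sheaf K (Type u)} (m : F ⟶ G) (n : G ⟶ H) (c : C)
    (x : F.obj.obj (op c)) :
    (m ≫ n).hom.app (op c) x = n.hom.app (op c) (m.hom.app (op c) x) := rfl

theorem over_w_app {V : Sheaf K (Type u)} {B B' : Over V} (φ : B ⟶ B') (c : C)
    (b : B.left.obj.obj (op c)) :
    B'.hom.hom.app (op c) (φ.left.hom.app (op c) b) = B.hom.hom.app (op c) b := by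
  rw [← comp_app, Over.w]

theorem isIso_iff_bijective_app {F G : Sheaf K (Type u)} (m : F ⟶ G) :
    IsIso m ↔ ∀ c, Function.Bijective (m.hom.app (op c)) := by
  rw [← isIso_iff_of_reflects_iso m (sheafToPresheaf K (Type u)), NatTrans.isIso_iff_isIso_app]
  constructor
  · intro h c
    exact (isIso_iff_bijective _).1 (h (op c))
  · rintro h ⟨c⟩
    exact (isIso_iff_bijective _).2 (h c)

/-- A global section of a sheaf of types. -/
structure GlobalSection (V : Sheaf K (Type u)) where
  val : ∀ c : C, V.obj.obj (op c)
  map_val : ∀ {c d : C} (f : d ⟶ c), V.obj.map f.op (val c) = val d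

/-! ### Pullback along a global section and its two adjoints. -/

namespace GlobalSection

variable {V : Sheaf K (Type u)}

/-- The image of a global section under a morphism of sheaves. -/
def map (s : GlobalSection V) {W : Sheaf K (Type u)} (m : V ⟶ W) : GlobalSection W where
  val c := m.hom.app (op c) (s.val c)
  map_val f := by rw [← hom_naturality, s.map_val]

variable (s : GlobalSection V)

/-- The presheaf of sections of `B` lying over a global section of `V`. -/
def fiberPresheaf (B : Over V) : Cᵒᵖ ⥤ Type u where
  obj c := { b : B.left.obj.obj c // B.hom.hom.app c b = s.val c.unop }
  map {c d} f := ↾fun b => ⟨B.left.obj.map f b.1, by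
    have := hom_naturality B.hom f.unop b.1
    rw [Quiver.Hom.op_unop] at this
    refine this.trans ?_
    rw [b.2]
    exact s.map_val f.unop⟩
  map_id c := by
    ext b
    exact Functor.map_id_apply B.left.obj c b.1
  map_comp f g := by
    ext b
    exact Functor.map_comp_apply B.left.obj f g b.1

/-- Gluing takes place in `B`; the glued section lies over `s` because this is a local condition in
the separated presheaf `V`. -/
theorem isSheaf_fiberPresheaf (B : Over V) : Presheaf.IsSheaf K (s.fiberPresheaf B) := by
  apply isSheaf_of_glue
  · intro c S hS a b h
    apply Subtype.ext
    exact separated B.left hS fun d f hf => congrArg Subtype.val (h f hf)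
  · intro c S hS x hx
    obtain ⟨t, ht⟩ := exists_glue B.left hS (fun d f hf => (x f hf).1)
      (fun d e f g hf => congrArg Subtype.val (hx f g hf))
    refine ⟨⟨t, separated V hS fun d f hf => ?_⟩, fun d f hf => Subtype.ext (ht f hf)⟩
    rw [← hom_naturality, ht f hf, (x f hf).2]
    exact (s.map_val f).symm

/-- Pullback along a global section `s` of `V`, as a functor from sheaves over `V` to sheaves. -/
def fiber : Over V ⥤ Sheaf K (Type u) where
  obj B := ⟨s.fiberPresheaf B, s.isSheaf_fiberPresheaf B⟩
  map φ := mkHom (fun c b => ⟨φ.left.hom.app (op c) b.1, (over_w_app φ c b.1).trans b.2⟩)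
    (fun f b => Subtype.ext (hom_naturality φ.left f b.1))
  map_id _ := rfl
  map_comp _ _ := rfl

/-- A sheaf as an object over `V`, via the constant map with value a global section. -/
def constOver (T : Sheaf K (Type u)) : Over V :=
  Over.mk (mkHom (fun c _ => s.val c) (fun f _ => (s.map_val f).symm) : T ⟶ V)

def constOverHomEquiv (T : Sheaf K (Type u)) (B : Over V) :
    (s.constOver T ⟶ B) ≃ (T ⟶ s.fiber.obj B) where
  toFun φ := mkHom (fun c t => ⟨φ.left.hom.app (op c) t, over_w_app φ c t⟩)
    (fun f t => Subtype.ext (hom_naturality φ.left f t))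
  invFun ψ := Over.homMk (mkHom (fun c t => (ψ.hom.app (op c) t).1)
      (fun f t => congrArg Subtype.val (hom_naturality ψ f t)))
    (hom_ext fun c t => (ψ.hom.app (op c) t).2)
  left_inv _ := rfl
  right_inv _ := rfl

/-- This adjoint makes `fiber` preserve finite limits; the other one, the dependent product,
supplies a direct image. Together they let `fiber` serve as an inverse image functor. -/
instance isRightAdjoint_fiber : s.fiber.IsRightAdjoint :=
  (Adjunction.adjunctionOfEquivLeft s.constOverHomEquiv (fun _ _ _ _ _ => rfl)).isRightAdjoint

/-- The sections over `c` of the dependent product of `D` along the global section `s`: a section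
`v` of `V` with a section of `D` on the locus where `v` agrees with `s`. -/
structure PiSection (D : Sheaf K (Type u)) (c : C) where
  base : V.obj.obj (op c)
  val : ∀ {d : C} (f : d ⟶ c), V.obj.map f.op base = s.val d → D.obj.obj (op d)
  map_val : ∀ {d e : C} (f : d ⟶ c) (g : e ⟶ d) (hf : V.obj.map f.op base = s.val d)
    (hgf : V.obj.map (g ≫ f).op base = s.val e), D.obj.map g.op (val f hf) = val (g ≫ f) hgf

variable {s} in
theorem PiSection.ext' {D : Sheaf K (Type u)} {c : C} {x y : PiSection s D c}
    (hb : x.base = y.base)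
    (hv : ∀ {d : C} (f : d ⟶ c) (hx : V.obj.map f.op x.base = s.val d)
      (hy : V.obj.map f.op y.base = s.val d), x.val f hx = y.val f hy) : x = y := by
  obtain ⟨v, x, hx⟩ := x
  obtain ⟨w, y, hy⟩ := y
  obtain rfl : v = w := hb
  congr
  funext d f h
  exact hv f h h

variable {s} in
theorem PiSection.val_congr {D : Sheaf K (Type u)} {c : C} {x y : PiSection s D c}
    (h : x = y) {d : C} {f g : d ⟶ c} (hfg : f = g) (hx : V.obj.map f.op x.base = s.val d)
    (hy : V.obj.map g.op y.base = s.val d) : x.val f hx = y.val g hy := by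
  subst h hfg; rfl

/-- Restriction of sections of the dependent product. -/
def PiSection.res {D : Sheaf K (Type u)} {c d : C} (f : d ⟶ c) (x : PiSection s D c) :
    PiSection s D d where
  base := V.obj.map f.op x.base
  val g hg := x.val (g ≫ f) (by rw [← map_map, hg])
  map_val g h hg hhg := by
    rw [x.map_val (g ≫ f) h _ (by rw [← Category.assoc, ← map_map, hhg])]
    exact PiSection.val_congr rfl (Category.assoc _ _ _).symm _ _

/-- The dependent product along a global section, as a presheaf. -/
def piPresheaf (D : Sheaf K (Type u)) : Cᵒᵖ ⥤ Type u where
  obj c := PiSection s D c.unop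
  map f := ↾(PiSection.res s f.unop)
  map_id c := by
    ext (x : PiSection s D c.unop)
    refine PiSection.ext' (x := PiSection.res s (𝟙 c.unop) x) (y := x)
      (by simp [PiSection.res]) fun f hx hy => ?_
    exact PiSection.val_congr (x := x) (y := x) rfl (Category.comp_id f) _ _
  map_comp {c d e} f g := by
    ext (x : PiSection s D c.unop)
    refine PiSection.ext' (x := PiSection.res s (g.unop ≫ f.unop) x)
      (y := PiSection.res s g.unop (PiSection.res s f.unop x))
      (by simp [PiSection.res]) fun h hx hy => ?_
    exact PiSection.val_congr (x := x) (y := x) rfl (Category.assoc _ _ _).symm _ _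

theorem isSheaf_piPresheaf (D : Sheaf K (Type u)) : Presheaf.IsSheaf K (s.piPresheaf D) := by
  apply isSheaf_of_glue
  · intro c S hS (x : PiSection s D c) (y : PiSection s D c) h
    have h' : ∀ ⦃d : C⦄ (f : d ⟶ c), S f → PiSection.res s f x = PiSection.res s f y :=
      fun d f hf => h f hf
    have hb : x.base = y.base :=
      separated V hS fun d f hf => congrArg PiSection.base (h' f hf)
    refine PiSection.ext' hb fun {d} f hx hy => ?_
    -- On the pulled-back sieve, the value at `g ≫ f` is the value at the identity of the
    -- restriction along `g ≫ f`, and those restrictions of `x` and `y` agree.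
    refine separated D (K.pullback_stable f hS) fun e g hg => ?_
    have hx' : V.obj.map (g ≫ f).op x.base = s.val e := by rw [← map_map, hx, s.map_val]
    have hy' : V.obj.map (g ≫ f).op y.base = s.val e := by rw [← map_map, hy, s.map_val]
    rw [x.map_val f g hx hx', y.map_val f g hy hy']
    have := PiSection.val_congr (h' (g ≫ f) hg) (rfl : 𝟙 e = 𝟙 e)
      (by simpa [PiSection.res] using hx') (by simpa [PiSection.res] using hy')
    exact (PiSection.val_congr (x := x) (y := x) rfl (Category.id_comp _).symm _ _).trans
      (this.trans (PiSection.val_congr (x := y) (y := y) rfl (Category.id_comp _) _ _))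
  · intro c S hS (x : ∀ ⦃d : C⦄ (f : d ⟶ c), S f → PiSection s D d)
      (hx : ∀ ⦃d e : C⦄ (f : d ⟶ c) (g : e ⟶ d) (hf : S f),
        PiSection.res s g (x f hf) = x (g ≫ f) (S.downward_closed hf g))
    obtain ⟨v, hv⟩ := exists_glue V hS (fun d f hf => (x f hf).base)
      (fun d e f g hf => congrArg PiSection.base (hx f g hf))
    have hxc : ∀ {d : C} {f f' : d ⟶ c} (_ : f = f') (hf : S f) (hf' : S f'),
        x f hf = x f' hf' := by
      rintro d f _ rfl _ _; rfl
    have hx_id : ∀ {d : C} (f : d ⟶ c) (hf : V.obj.map f.op v = s.val d) {e : C} (g : e ⟶ d)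
        (hg : S (g ≫ f)), V.obj.map (𝟙 e).op (x (g ≫ f) hg).base = s.val e := by
      intro d f hf e g hg
      rw [← hv, map_map, Category.id_comp, ← map_map, hf, s.map_val]
    -- The value of the glued partial section at `f` is itself glued in `D`, over the pullback of
    -- `S` along `f`, from the values of the `x (g ≫ f)` at identities.
    have key : ∀ {d : C} (f : d ⟶ c) (hf : V.obj.map f.op v = s.val d),
        ∃ t : D.obj.obj (op d), ∀ ⦃e : C⦄ (g : e ⟶ d) (hg : S (g ≫ f)),
          D.obj.map g.op t = (x (g ≫ f) hg).val (𝟙 e) (hx_id f hf g hg) := by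
      intro d f hf
      refine exists_glue D (K.pullback_stable f hS)
        (fun e g hg => (x (g ≫ f) hg).val (𝟙 e) (hx_id f hf g hg)) ?_
      intro e e' g h hg
      have hh : V.obj.map (h ≫ 𝟙 e).op (x (g ≫ f) hg).base = s.val e' := by
        rw [← map_map, hx_id f hf g hg, s.map_val]
      rw [(x (g ≫ f) hg).map_val (𝟙 e) h (hx_id f hf g hg) hh]
      have h1 : PiSection.res s h (x (g ≫ f) hg) = x ((h ≫ g) ≫ f)
          (by rw [Category.assoc]; exact S.downward_closed hg h) := by
        exact (hx (g ≫ f) h hg).trans (hxc (Category.assoc _ _ _).symm _ _)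
      refine Eq.trans ?_ (PiSection.val_congr h1 (rfl : 𝟙 e' = 𝟙 e') (by
        rw [h1]; exact hx_id f hf (h ≫ g) _) _)
      exact PiSection.val_congr (x := x (g ≫ f) hg) (y := x (g ≫ f) hg) rfl
        ((Category.comp_id _).trans (Category.id_comp _).symm) _ _
    choose t ht using @key
    refine ⟨(⟨v, fun f hf => t f hf, ?_⟩ : PiSection s D c), ?_⟩
    · intro d e f g hf hgf
      refine separated D (K.pullback_stable (g ≫ f) hS) fun e' h hh => ?_
      rw [map_map, ht f hf (h ≫ g) (by rw [Category.assoc]; exact hh), ht (g ≫ f) hgf h hh]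
      exact PiSection.val_congr (hxc (Category.assoc _ _ _) _ _) rfl _ _
    · intro d f hf
      refine PiSection.ext' (hv f hf) fun {e} g hg hg' => ?_
      have h1 : V.obj.map (g ≫ f).op v = s.val e := by rw [← map_map]; exact hg
      have h2 := ht (g ≫ f) h1 (𝟙 e) (by
        rw [Category.id_comp]; exact S.downward_closed hf g)
      have h3 : PiSection.res s g (x f hf) = x (𝟙 e ≫ g ≫ f)
          (by rw [Category.id_comp]; exact S.downward_closed hf g) := by
        exact (hx f g hf).trans (hxc (Category.id_comp _).symm _ _)
      have h4 : t (g ≫ f) h1 = (x (𝟙 e ≫ g ≫ f) (by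
          rw [Category.id_comp]; exact S.downward_closed hf g)).val (𝟙 e)
          (hx_id (g ≫ f) h1 (𝟙 e) _) := by
        rw [← h2]; simp
      refine h4.trans (Eq.trans (PiSection.val_congr h3 (rfl : 𝟙 e = 𝟙 e) (by
        rw [h3]; exact hx_id (g ≫ f) h1 (𝟙 e) _) _).symm ?_)
      exact PiSection.val_congr (x := x f hf) (y := x f hf) rfl (Category.id_comp _) _ _

/-- The dependent product along a global section, as an object over `V`. -/
def piOver (D : Sheaf K (Type u)) : Over V :=
  Over.mk (mkHom (F := ⟨s.piPresheaf D, s.isSheaf_piPresheaf D⟩)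
    (fun _ (x : PiSection s D _) => x.base) (fun _ _ => rfl))

def piOverHomEquiv (B : Over V) (D : Sheaf K (Type u)) :
    (s.fiber.obj B ⟶ D) ≃ (B ⟶ s.piOver D) where
  toFun φ := Over.homMk (mkHom (G := (s.piOver D).left)
      (fun c b => (⟨B.hom.hom.app (op c) b,
        fun {d} f hf => φ.hom.app (op d) ⟨B.left.obj.map f.op b, by
          rw [← hf]; exact hom_naturality B.hom f b⟩,
        fun {d e} f g hf hgf => (hom_naturality φ g _).symm.trans
          (congrArg (φ.hom.app (op e)) (Subtype.ext (map_map B.left.obj f g b)))⟩ : PiSection s D c))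
      (fun {c d} f b => by
        refine PiSection.ext' (hom_naturality B.hom f b) fun {e} g hx hy => ?_
        exact congrArg (φ.hom.app (op e)) (Subtype.ext (map_map B.left.obj f g b))))
    (hom_ext fun c b => rfl)
  -- Evaluation at the identity is allowed because `b` lies over `s`, so the base of its image is
  -- `s.val c`.
  invFun ψ := mkHom (fun c b => PiSection.val (s := s) (D := D)
        (ψ.left.hom.app (op c) b.1) (𝟙 c)
        ((congrArg _ ((over_w_app ψ c b.1).trans b.2)).trans (s.map_val _)))
    (fun {c d} f b => by
      have h1 : PiSection.base (s := s) (D := D) (ψ.left.hom.app (op c) b.1) = s.val c :=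
        (over_w_app ψ c b.1).trans b.2
      refine Eq.trans ?_ (PiSection.map_val (s := s) (D := D) (ψ.left.hom.app (op c) b.1)
        (𝟙 c) f _ ((congrArg _ h1).trans (s.map_val _))).symm
      refine (PiSection.val_congr (y := PiSection.res s f (ψ.left.hom.app (op c) b.1))
        (hom_naturality ψ.left f b.1) (rfl : 𝟙 d = 𝟙 d) _ (by
          rw [op_id, Functor.map_id_apply]
          exact (congrArg _ h1).trans (s.map_val f))).trans ?_
      exact PiSection.val_congr (x := ψ.left.hom.app (op c) b.1)
        (y := ψ.left.hom.app (op c) b.1) rfl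
        ((Category.id_comp _).trans (Category.comp_id _).symm) _ _)
  left_inv φ := by
    refine hom_ext fun c b => ?_
    exact congrArg (φ.hom.app (op c)) (Subtype.ext (Functor.map_id_apply B.left.obj _ b.1))
  right_inv ψ := by
    apply Over.OverMorphism.ext
    refine hom_ext fun c b => ?_
    refine PiSection.ext' (s := s) (D := D) ?_ fun {d} f hx hy => ?_
    · exact (over_w_app ψ c b).symm
    · refine (PiSection.val_congr (y := PiSection.res s f (ψ.left.hom.app (op c) b))
        (hom_naturality ψ.left f b) (rfl : 𝟙 d = 𝟙 d) _ (by
          rw [op_id, Functor.map_id_apply]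
          exact hy)).trans ?_
      exact PiSection.val_congr (x := ψ.left.hom.app (op c) b)
        (y := ψ.left.hom.app (op c) b) rfl (Category.id_comp _) _ _

theorem piOverHomEquiv_naturality_left (B' B : Over V) (D : Sheaf K (Type u)) (f : B' ⟶ B)
    (g : s.fiber.obj B ⟶ D) :
    s.piOverHomEquiv B' D (s.fiber.map f ≫ g) = f ≫ s.piOverHomEquiv B D g := by
  apply Over.OverMorphism.ext
  refine hom_ext fun c b => ?_
  refine PiSection.ext' (s := s) (D := D) (over_w_app f c b).symm fun {d} k hx hy => ?_
  exact congrArg (g.hom.app (op d)) (Subtype.ext (hom_naturality f.left k b))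

instance isLeftAdjoint_fiber : s.fiber.IsLeftAdjoint :=
  (Adjunction.adjunctionOfEquivRight s.piOverHomEquiv s.piOverHomEquiv_naturality_left).isLeftAdjoint

end GlobalSection

end SheafOfTypes

/-! ### Localization of a topos at an object, on the level of sites. -/

/-- The category of local sections of a presheaf `U` on `C`: its objects are the sections of `U`
over the objects of `C`. -/
structure LocalSections {C : Type u} [SmallCategory C] (U : Cᵒᵖ ⥤ Type u) : Type u where
  pt : C
  val : U.obj (op pt)

namespace LocalSections

open SheafOfTypes

variable {C : Type u} [SmallCategory C]

section

variable {U : Cᵒᵖ ⥤ Type u}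

instance : SmallCategory (LocalSections U) where
  Hom x y := { f : x.pt ⟶ y.pt // U.map f.op y.val = x.val }
  id x := ⟨𝟙 _, by simp⟩
  comp f g := ⟨f.1 ≫ g.1, by rw [← map_map, g.2, f.2]⟩

/-- The restriction of a local section along `f`, as a morphism. -/
def lift (x : LocalSections U) {d : C} (f : d ⟶ x.pt) :
    (⟨d, U.map f.op x.val⟩ : LocalSections U) ⟶ x :=
  ⟨f, rfl⟩

/-- A morphism of local sections, with its source rewritten as a restriction of its target. -/
def toLift {x y : LocalSections U} (φ : y ⟶ x) :
    y ⟶ (⟨y.pt, U.map φ.1.op x.val⟩ : LocalSections U) :=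
  ⟨𝟙 _, by simpa using φ.2⟩

/-- The inverse of `toLift`. -/
def ofLift {x y : LocalSections U} (φ : y ⟶ x) :
    (⟨y.pt, U.map φ.1.op x.val⟩ : LocalSections U) ⟶ y :=
  ⟨𝟙 _, by simpa using φ.2.symm⟩

theorem toLift_lift {x y : LocalSections U} (φ : y ⟶ x) : toLift φ ≫ lift x φ.1 = φ :=
  Subtype.ext (Category.id_comp _)

theorem ofLift_comp {x y : LocalSections U} (φ : y ⟶ x) : ofLift φ ≫ φ = lift x φ.1 :=
  Subtype.ext (Category.id_comp _)

/-- Restriction between two restrictions of a local section. -/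
def liftComp (x : LocalSections U) {d e : C} (f : d ⟶ x.pt) (g : e ⟶ d) :
    (⟨e, U.map (g ≫ f).op x.val⟩ : LocalSections U) ⟶ ⟨d, U.map f.op x.val⟩ :=
  ⟨g, map_map U f g x.val⟩

/-- The sieve on the underlying object of `C` corresponding to a sieve on a local section. -/
def pushSieve {x : LocalSections U} (S : Sieve x) : Sieve x.pt where
  arrows _ f := S (lift x f)
  downward_closed {_ _ f} hf g := S.downward_closed hf (liftComp x f g)

theorem pushSieve_iff {x y : LocalSections U} (S : Sieve x) (φ : y ⟶ x) :
    pushSieve S φ.1 ↔ S φ := by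
  constructor
  · intro h
    rw [← toLift_lift φ]
    exact S.downward_closed h _
  · intro h
    change S (lift x φ.1)
    rw [← ofLift_comp φ]
    exact S.downward_closed h _

theorem pushSieve_pullback {x y : LocalSections U} (S : Sieve x) (φ : y ⟶ x) :
    pushSieve (S.pullback φ) = (pushSieve S).pullback φ.1 := by
  ext d f
  exact (pushSieve_iff S (lift y f ≫ φ)).symm

/-- The topology on the category of local sections for which a sieve covers when the underlying
sieve does. -/
def topology (U : Cᵒᵖ ⥤ Type u) (J : GrothendieckTopology C) :
    GrothendieckTopology (LocalSections U) where
  sieves x := { S | pushSieve S ∈ J x.pt }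
  top_mem' x := J.superset_covering (fun _ _ _ => trivial) (J.top_mem x.pt)
  pullback_stable' x y S φ hS := by
    change pushSieve (S.pullback φ) ∈ J y.pt
    rw [pushSieve_pullback]
    exact J.pullback_stable φ.1 hS
  transitive' x S hS R hR := by
    refine J.transitive hS _ fun d f hf => ?_
    have := hR (f := lift x f) hf
    change pushSieve (R.pullback (lift x f)) ∈ J d at this
    rwa [pushSieve_pullback] at this

/-- The underlying object of a local section. -/
def proj (U : Cᵒᵖ ⥤ Type u) : LocalSections U ⥤ C where
  obj x := x.pt
  map φ := φ.1

instance (J : GrothendieckTopology C) : (proj U).IsCocontinuous (topology U J) J where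
  cover_lift hS := hS

instance (J : GrothendieckTopology C) : (proj U).IsContinuous (topology U J) J where
  op_comp_isSheaf_of_types G := by
    rw [← isSheaf_iff_isSheaf_of_type]
    apply isSheaf_of_glue
    · intro x S hS a b h
      exact separated G hS fun d f hf => h (lift x f) hf
    · intro x S hS t ht
      obtain ⟨v, hv⟩ := exists_glue G hS (fun d f hf => t (lift x f) hf)
        (fun d e f g hf => ht (lift x f) (liftComp x f g) hf)
      refine ⟨v, fun y φ hφ => ?_⟩
      -- Gluing prescribed values only on the arrows `lift x f`; a general `φ` differs from `lift x
      -- φ.1` by `toLift φ`, whose underlying arrow is an identity.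
      have h1 := (pushSieve_iff S φ).2 hφ
      refine (hv φ.1 h1).trans ?_
      have h2 := ht (lift x φ.1) (toLift φ) h1
      have h3 : t (lift x φ.1) h1 = t (toLift φ ≫ lift x φ.1) (S.downward_closed h1 _) :=
        (Functor.map_id_apply G.obj _ _).symm.trans h2
      rw [h3]
      congr 1
      exact toLift_lift φ

end

variable {J : GrothendieckTopology C} (U : Sheaf J (Type u))

/-- The geometric morphism to a category of sheaves from the sheaves on the category of local
sections of one of its objects. -/
noncomputable def geometricMorphism :
    GeometricMorphism (Sheaf (topology U.obj J) (Type u)) (Sheaf J (Type u)) where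
  inverseImage := (proj U.obj).sheafPushforwardContinuous (Type u) (topology U.obj J) J
  directImage := (proj U.obj).sheafPushforwardCocontinuous (Type u) (topology U.obj J) J
  adj := (proj U.obj).sheafAdjunctionCocontinuous (Type u) (topology U.obj J) J
  -- Finite limits of sheaves are computed on presheaves, where the inverse image is precomposition.
  preservesFiniteLimits := by
    have : PreservesFiniteLimits
        ((proj U.obj).sheafPushforwardContinuous (Type u) (topology U.obj J) J ⋙
          sheafToPresheaf _ _) :=
      inferInstanceAs (PreservesFiniteLimits (sheafToPresheaf J (Type u) ⋙
        (Functor.whiskeringLeft _ _ _).obj (proj U.obj).op))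
    exact preservesFiniteLimits_of_reflects_of_preserves _ (sheafToPresheaf _ _)

/-- The tautological global section of the inverse image of `U`. -/
noncomputable def tautologicalSection :
    GlobalSection ((geometricMorphism U).inverseImage.obj U) where
  val x := x.val
  map_val φ := φ.2

/-- A section `t` of `T` over `c` is sent by `a` to a local section of `U`, and the component of the
restricted morphism there is `m` at `c`. So `m` is bijective wherever `T` is inhabited, which is all
that maps out of `T` see. -/
theorem bijective_comp_of_isIso {F G : Sheaf J (Type u)} (m : F ⟶ G)
    (hm : IsIso ((geometricMorphism U).inverseImage.map m)) {T : Sheaf J (Type u)} (a : T ⟶ U) :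
    Function.Bijective (fun f : T ⟶ F => f ≫ m) := by
  rw [isIso_iff_bijective_app] at hm
  have hb : ∀ (c : C), T.obj.obj (op c) → Function.Bijective (m.hom.app (op c)) :=
    fun c t => hm ⟨c, a.hom.app (op c) t⟩
  constructor
  · intro f g h
    refine hom_ext fun c t => (hb c t).1 ?_
    rw [← comp_app, ← comp_app]
    exact congrArg (fun k : T ⟶ G => k.hom.app (op c) t) h
  · intro g
    choose y hy using fun c t => (hb c t).2 (g.hom.app (op c) t)
    refine ⟨mkHom y fun {c d} f t => (hb d (T.obj.map f.op t)).1 ?_, hom_ext hy⟩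
    rw [hy, hom_naturality, hom_naturality, hy]

end LocalSections

instance isGrothendieckTopos_sheaf {C : Type u} [SmallCategory C] (J : GrothendieckTopology C) :
    IsGrothendieckTopos (Sheaf J (Type u)) :=
  ⟨⟨C, inferInstance, J, ⟨CategoryTheory.Equivalence.refl⟩⟩⟩

/-- The geometric morphism given by an equivalence of categories. -/
def GeometricMorphism.ofEquivalence {E F : Type (u + 1)} [LargeCategory.{u} E]
    [LargeCategory.{u} F] (e : F ≌ E) : GeometricMorphism E F where
  inverseImage := e.functor
  directImage := e.inverse
  adj := e.toAdjunction
  preservesFiniteLimits := inferInstance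

/-- Every object `U` of a topos acquires a global section over some topos which detects
isomorphisms after localization at `U`. -/
theorem IsGrothendieckTopos.exists_globalSection {E : Type (u + 1)} [LargeCategory.{u} E]
    [h : IsGrothendieckTopos E] (U : E) :
    ∃ (C : Type u) (_ : SmallCategory C) (K : GrothendieckTopology C)
      (p : GeometricMorphism (Sheaf K (Type u)) E)
      (_ : SheafOfTypes.GlobalSection (p.inverseImage.obj U)),
      ∀ {F G : E} (m : F ⟶ G), IsIso (p.inverseImage.map m) → ∀ {T : E} (_ : T ⟶ U),
        Function.Bijective (fun f : T ⟶ F => f ≫ m) := by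
  obtain ⟨C, _, J, ⟨e⟩⟩ := h.exists_site
  refine ⟨_, _, _, (LocalSections.geometricMorphism (e.functor.obj U)).comp
    (GeometricMorphism.ofEquivalence e), LocalSections.tautologicalSection _, ?_⟩
  intro F G m hm T a
  have := LocalSections.bijective_comp_of_isIso _ (e.functor.map m) hm (e.functor.map a)
  rw [← Function.Bijective.of_comp_iff' (e.fullyFaithfulFunctor.homEquiv (X := T) (Y := G)).bijective]
  convert this.comp (e.fullyFaithfulFunctor.homEquiv (X := T) (Y := F)).bijective using 1
  funext f
  exact e.functor.map_comp f m

theorem nonempty_monoidalClosed_sheaf {C : Type u} [SmallCategory C]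
    (J : GrothendieckTopology C) : Nonempty (MonoidalClosed (Sheaf J (Type u))) :=
  ⟨inferInstance⟩

/-! ### Covers of the terminal object and local detection of isomorphisms. -/

section

open MonoidalCategory CartesianMonoidalCategory

variable {E : Type (u + 1)} [LargeCategory.{u} E]

theorem IsGrothendieckTopos.balanced [h : IsGrothendieckTopos E] : Balanced E where
  isIso_of_mono_of_epi f _ _ := by
    obtain ⟨C, _, J, ⟨e⟩⟩ := h.exists_site
    have : IsIso (e.functor.map f) := isIso_of_mono_of_epi _
    exact isIso_of_reflects_iso f e.functor

theorem IsGrothendieckTopos.nonempty_monoidalClosed [h : IsGrothendieckTopos E]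
    [CartesianMonoidalCategory E] : Nonempty (MonoidalClosed E) := by
  obtain ⟨C, _, J, ⟨e⟩⟩ := h.exists_site
  obtain ⟨m⟩ := nonempty_monoidalClosed_sheaf J
  exact ⟨@cartesianClosedOfEquiv _ _ _ _ _ _ e.symm m⟩

theorem IsGrothendieckTopos.hasLimits (E : Type (u + 1)) [LargeCategory.{u} E]
    [h : IsGrothendieckTopos E] : HasLimits E := by
  obtain ⟨C, _, J, ⟨e⟩⟩ := h.exists_site
  exact Adjunction.has_limits_of_equivalence e.functor

/-- A family of objects covers if its morphisms to the terminal object are jointly epic. -/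
def JointlyCovers [HasTerminal E] {ι : Type*} (U : ι → E) : Prop :=
  ∀ ⦃Z : E⦄ (a b : ⊤_ E ⟶ Z), (∀ i, terminal.from (U i) ≫ a = terminal.from (U i) ≫ b) → a = b

/-- Cartesian closedness turns maps out of `T` into maps from the terminal object to an exponential,
so a cover of the terminal object remains jointly epic after multiplying by `T`. -/
theorem JointlyCovers.hom_ext [IsGrothendieckTopos E] {ι : Type*} {U : ι → E}
    (hU : JointlyCovers U) {T Z : E} {a b : T ⟶ Z}
    (h : ∀ (i : ι) {T' : E} (_ : T' ⟶ U i) (t : T' ⟶ T), t ≫ a = t ≫ b) : a = b := by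
  let _ : CartesianMonoidalCategory E := CartesianMonoidalCategory.ofHasFiniteProducts
  obtain ⟨_⟩ := IsGrothendieckTopos.nonempty_monoidalClosed (E := E)
  have key : ∀ (i : ι) (c : T ⟶ Z), terminal.from (U i) ≫
      MonoidalClosed.curry (fst T (⊤_ E) ≫ c) = MonoidalClosed.curry (fst T (U i) ≫ c) := by
    intro i c
    rw [← MonoidalClosed.curry_natural_left, whiskerLeft_fst_assoc]
  have h1 : MonoidalClosed.curry (fst T (⊤_ E) ≫ a) = MonoidalClosed.curry (fst T (⊤_ E) ≫ b) :=
    hU _ _ fun i => by rw [key, key, h i (snd T (U i)) (fst T (U i))]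
  have h2 := MonoidalClosed.curry_injective h1
  simpa using congrArg (fun k => lift (𝟙 T) (terminal.from T) ≫ k) h2

/-- A topos is balanced, and both mono and epi can be tested after restricting to objects over the
`U i`. -/
theorem JointlyCovers.isIso [IsGrothendieckTopos E] {ι : Type*} {U : ι → E}
    (hU : JointlyCovers U) {F G : E} (m : F ⟶ G)
    (hm : ∀ (i : ι) {T : E} (_ : T ⟶ U i), Function.Bijective (fun f : T ⟶ F => f ≫ m)) :
    IsIso m := by
  have := IsGrothendieckTopos.balanced (E := E)
  have : Mono m := ⟨fun a b hab => hU.hom_ext fun i T' u t => (hm i u).1 (by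
    simp only [Category.assoc, hab])⟩
  have : Epi m := ⟨fun a b hab => hU.hom_ext fun i T' u t => by
    obtain ⟨f, rfl⟩ := (hm i u).2 t
    simp only [Category.assoc, hab]⟩
  exact isIso_of_mono_of_epi m

/-- The inverse image preserves the terminal object, so two maps out of it can be compared after
transposing to `X`. -/
theorem JointlyCovers.inverseImage {X : Type (u + 1)} [LargeCategory.{u} X] [HasTerminal X]
    [HasTerminal E] {ι : Type*} {U : ι → X} (hU : JointlyCovers U) (f : GeometricMorphism E X) :
    JointlyCovers fun i => f.inverseImage.obj (U i) := by
  intro Z a b h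
  have hiso : IsIso (terminal.from (f.inverseImage.obj (⊤_ X))) :=
    inferInstanceAs (IsIso (terminalComparison f.inverseImage))
  rw [← cancel_epi (terminal.from (f.inverseImage.obj (⊤_ X)))]
  apply (f.adj.homEquiv _ _).injective
  apply hU
  intro i
  rw [← f.adj.homEquiv_naturality_left, ← f.adj.homEquiv_naturality_left]
  congr 1
  simpa only [← Category.assoc, terminal.comp_from] using h i

theorem GeometricMorphism.isIso_natTrans {E X : Type (u + 1)} [LargeCategory.{u} E]
    [LargeCategory.{u} X] {f g : GeometricMorphism E X} (α : f ⟶ g) [IsIso α] :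
    IsIso α.natTrans :=
  ⟨(inv α).natTrans, congrArg Hom.natTrans (IsIso.hom_inv_id α),
    congrArg Hom.natTrans (IsIso.inv_hom_id α)⟩

theorem GeometricMorphism.isIso_of_natTrans {E X : Type (u + 1)} [LargeCategory.{u} E]
    [LargeCategory.{u} X] {f g : GeometricMorphism E X} (α : f ⟶ g) (h : IsIso α.natTrans) :
    IsIso α :=
  ⟨⟨inv α.natTrans⟩, Hom.ext (IsIso.hom_inv_id α.natTrans), Hom.ext (IsIso.inv_hom_id α.natTrans)⟩

end

/-! ### Inverse image functors induced on slices. -/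

namespace CategoryTheory.Over

variable {C D : Type (u + 1)} [LargeCategory.{u} C] [LargeCategory.{u} D]

theorem homEquiv_comp_map_iff {L : C ⥤ D} {R : D ⥤ C} (adj : L ⊣ R) {A B : C} {B' : D}
    (φ : L.obj B ⟶ B') (b : B' ⟶ L.obj A) (a : B ⟶ A) :
    adj.homEquiv _ _ φ ≫ R.map b = a ≫ adj.unit.app A ↔ φ ≫ b = L.map a := by
  rw [← adj.homEquiv_naturality_right, ← adj.homEquiv_id, ← adj.homEquiv_naturality_left,
    (adj.homEquiv _ _).apply_eq_iff_eq, Category.comp_id]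

section

variable [HasPullbacks C] {L : C ⥤ D} {R : D ⥤ C} (adj : L ⊣ R) {A : C}

/-- The value of the right adjoint of `Over.post L` at an object. -/
noncomputable def postRightAdjointObj (B : Over (L.obj A)) : Over A :=
  Over.mk (pullback.snd (R.map B.hom) (adj.unit.app A))

/-- The bijection exhibiting `Over.post L` as a left adjoint. -/
noncomputable def postHomEquiv (B : Over A) (B' : Over (L.obj A)) :
    ((Over.post L).obj B ⟶ B') ≃ (B ⟶ postRightAdjointObj adj B') where
  toFun φ := Over.homMk (pullback.lift (adj.homEquiv B.left B'.left φ.left) B.hom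
    ((homEquiv_comp_map_iff adj _ _ _).2 (Over.w φ))) (pullback.lift_snd _ _ _)
  invFun ψ := Over.homMk (U := (Over.post L).obj B)
    ((adj.homEquiv B.left B'.left).symm (ψ.left ≫ pullback.fst _ _))
    ((homEquiv_comp_map_iff adj _ _ _).1 (by
      rw [Equiv.apply_symm_apply]
      exact (Category.assoc _ _ _).trans ((congrArg (ψ.left ≫ ·) pullback.condition).trans
        ((Category.assoc _ _ _).symm.trans (congrArg (· ≫ _) (Over.w ψ))))))
  left_inv φ := by
    apply Over.OverMorphism.ext
    exact (congrArg _ (pullback.lift_fst _ _ _)).trans (Equiv.symm_apply_apply _ _)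
  right_inv ψ := by
    apply Over.OverMorphism.ext
    apply pullback.hom_ext
    · exact (pullback.lift_fst _ _ _).trans (Equiv.apply_symm_apply _ _)
    · exact (pullback.lift_snd _ _ _).trans (Over.w ψ).symm

/-- The right adjoint applies `R` and then pulls back along the unit at `A`. -/
theorem post_isLeftAdjoint (adj : L ⊣ R) (A : C) : (Over.post (X := A) L).IsLeftAdjoint := by
  refine (Adjunction.adjunctionOfEquivRight (postHomEquiv adj) ?_).isLeftAdjoint
  intro B' B D' f g
  apply Over.OverMorphism.ext
  apply pullback.hom_ext
  · exact (pullback.lift_fst _ _ _).trans ((adj.homEquiv_naturality_left f.left g.left).trans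
      ((congrArg (f.left ≫ ·) (pullback.lift_fst _ _ _).symm).trans (Category.assoc _ _ _).symm))
  · exact (pullback.lift_snd _ _ _).trans ((Over.w f).symm.trans
      ((congrArg (f.left ≫ ·) (pullback.lift_snd _ _ _).symm).trans (Category.assoc _ _ _).symm))

end

/-- Pullbacks in a slice are computed in the base category, and the terminal object is an identity.
-/
theorem post_preservesFiniteLimits [HasFiniteLimits C] [HasFiniteLimits D] (L : C ⥤ D)
    [PreservesFiniteLimits L] (A : C) : PreservesFiniteLimits (Over.post (X := A) L) := by
  have : PreservesLimitsOfShape WalkingCospan (Over.post (X := A) L ⋙ Over.forget (L.obj A)) :=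
    inferInstanceAs (PreservesLimitsOfShape WalkingCospan (Over.forget A ⋙ L))
  have : PreservesLimitsOfShape WalkingCospan (Over.post (X := A) L) :=
    preservesLimitsOfShape_of_reflects_of_preserves _ (Over.forget (L.obj A))
  have : PreservesLimit (Functor.empty.{0} (Over A)) (Over.post (X := A) L) := by
    refine preservesLimit_of_preserves_limit_cone Over.mkIdTerminal ?_
    exact (isLimitMapConeEmptyConeEquiv _ _).symm
      (Over.mkIdTerminal.ofIso (Over.isoMk (Iso.refl _) ((Category.id_comp _).trans
        (L.map_id A))))
  have : PreservesLimitsOfShape (Discrete PEmpty.{1}) (Over.post (X := A) L) :=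
    preservesLimitsOfShape_pempty_of_preservesTerminal _
  exact preservesFiniteLimits_of_preservesTerminal_and_pullbacks _

end CategoryTheory.Over

theorem existsUnique_of_isLimit_binaryFan {X : Type (u + 1)} [LargeCategory.{u} X]
    (P : X ⥤ Type u) [PreservesFiniteLimits P] {Q A F : X} {q : Q ⟶ A} {p : Q ⟶ F}
    (hQ : IsLimit (BinaryFan.mk q p)) (a : P.obj A) (x : P.obj F) :
    ∃! z : P.obj Q, P.map q z = a ∧ P.map p z = x := by
  have h : IsLimit (BinaryFan.mk (P.map q) (P.map p)) :=
    mapIsLimitOfPreservesOfIsLimit P _ _ hQ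
  let l := BinaryFan.IsLimit.lift' h (↾fun _ : PUnit => a) (↾fun _ : PUnit => x)
  refine ⟨l.1 PUnit.unit, ⟨?_, ?_⟩, ?_⟩
  · exact congrArg (fun k : PUnit ⟶ P.obj A => k PUnit.unit) l.2.1
  · exact congrArg (fun k : PUnit ⟶ P.obj F => k PUnit.unit) l.2.2
  · rintro z ⟨hz₁, hz₂⟩
    have : (↾fun _ : PUnit => z) = l.1 := by
      apply BinaryFan.IsLimit.hom_ext h
      · refine Eq.trans ?_ l.2.1.symm
        ext
        exact hz₁
      · refine Eq.trans ?_ l.2.2.symm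
        ext
        exact hz₂
    rw [← this]
    rfl

/-! ### Lifting through a slice, and étale descent. -/

namespace GeometricMorphism

open SheafOfTypes

variable {C : Type u} [SmallCategory C] {K : GrothendieckTopology C}
  {X : Type (u + 1)} [LargeCategory.{u} X]

/-- The lift of a geometric morphism `h` to `X` through an étale geometric morphism, given by a
global section of the inverse image of the corresponding object `A`. -/
noncomputable def liftOver [HasFiniteLimits X] {Y : Type (u + 1)} [LargeCategory.{u} Y] {A : X}
    (e : Over A ≌ Y)
    (h : GeometricMorphism (Sheaf K (Type u)) X) (s : GlobalSection (h.inverseImage.obj A)) :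
    GeometricMorphism (Sheaf K (Type u)) Y where
  inverseImage := e.inverse ⋙ Over.post h.inverseImage ⋙ s.fiber
  directImage := (Functor.rightAdjoint s.fiber) ⋙
    (@Functor.rightAdjoint _ _ _ _ (Over.post (X := A) h.inverseImage)
      (Over.post_isLeftAdjoint h.adj A)) ⋙ e.functor
  adj := (e.symm.toAdjunction.comp
    ((@Adjunction.ofIsLeftAdjoint _ _ _ _ _ (Over.post_isLeftAdjoint h.adj A)).comp
      (Adjunction.ofIsLeftAdjoint s.fiber)))
  preservesFiniteLimits := by
    have := Over.post_preservesFiniteLimits h.inverseImage A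
    infer_instance

theorem natTrans_naturality_app {h k : GeometricMorphism (Sheaf K (Type u)) X} (α : h ⟶ k)
    {V W : X} (q : V ⟶ W) (c : C) (z : (h.inverseImage.obj V).obj.obj (op c)) :
    (k.inverseImage.map q).hom.app (op c) ((α.natTrans.app V).hom.app (op c) z) =
      (α.natTrans.app W).hom.app (op c) ((h.inverseImage.map q).hom.app (op c) z) := by
  rw [← comp_app, ← comp_app, α.natTrans.naturality]

/-- The action of a 2-cell on fibers over a global section. -/
def fiberNatTrans {h k : GeometricMorphism (Sheaf K (Type u)) X} (α : h ⟶ k) {A : X}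
    (s : GlobalSection (h.inverseImage.obj A)) :
    Over.post h.inverseImage ⋙ s.fiber ⟶
      Over.post k.inverseImage ⋙ (s.map (α.natTrans.app A)).fiber where
  app B := mkHom (fun c b => ⟨(α.natTrans.app B.left).hom.app (op c) b.1,
      (natTrans_naturality_app α B.hom c b.1).trans (congrArg _ b.2)⟩)
    (fun f b => Subtype.ext (hom_naturality (α.natTrans.app B.left) f b.1))
  naturality B B' φ := by
    exact hom_ext fun c b => Subtype.ext (natTrans_naturality_app α φ.left c b.1).symm

/-- The sections `s` and `α s` lift `h` and `k` to `Y`, and the 2-cell induced by `α` is invertible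
because `Y` is grouplike. At `A ⨯ F` the fiber over `s` is a copy of `h^* F`, so invertibility there
is invertibility of `α` at `F`. -/
theorem isIso_natTrans_of_globalSection [HasFiniteLimits X] {Y : Type (u + 1)} [LargeCategory.{u} Y]
    (hY : IsGrouplike Y) {A : X} (e : Over A ≌ Y)
    {h k : GeometricMorphism (Sheaf K (Type u)) X} (α : h ⟶ k)
    (s : GlobalSection (h.inverseImage.obj A)) (F : X) : IsIso (α.natTrans.app F) := by
  have := hY.isGroupoid (Sheaf K (Type u))
  let β : liftOver e h s ⟶ liftOver e k (s.map (α.natTrans.app A)) :=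
    ⟨Functor.whiskerLeft e.inverse (fiberNatTrans α s)⟩
  have : IsIso β := IsGroupoid.all_isIso β
  have hβ : IsIso β.natTrans := isIso_natTrans β
  let B : Over A := Over.mk (prod.fst : A ⨯ F ⟶ A)
  -- `β` only sees objects of the form `e.inverse.obj _`; the unit of `e` transfers the conclusion
  -- to `B`.
  have hB : IsIso ((fiberNatTrans α s).app B) := by
    refine (NatTrans.isIso_app_iff_of_iso (fiberNatTrans α s) (e.unitIso.app B)).2 ?_
    exact inferInstanceAs (IsIso (β.natTrans.app (e.functor.obj B)))
  rw [isIso_iff_bijective_app] at hB ⊢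
  intro c
  -- Over each `c`, a section `x` of the image of `F` is paired with `s.val c` to give a section of
  -- the image of `A ⨯ F` lying over `s`.
  let ev := sheafToPresheaf K (Type u) ⋙ (evaluation _ _).obj (op c)
  have hh := existsUnique_of_isLimit_binaryFan (h.inverseImage ⋙ ev) (prodIsProd A F)
  have hk := existsUnique_of_isLimit_binaryFan (k.inverseImage ⋙ ev) (prodIsProd A F)
  constructor
  · intro x x' hx
    obtain ⟨z, ⟨hz1, hz2⟩, -⟩ := hh (s.val c) x
    obtain ⟨z', ⟨hz1', hz2'⟩, -⟩ := hh (s.val c) x'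
    have h1 : (α.natTrans.app (A ⨯ F)).hom.app (op c) z =
        (α.natTrans.app (A ⨯ F)).hom.app (op c) z' := by
      refine (hk ((α.natTrans.app A).hom.app (op c) (s.val c))
        ((α.natTrans.app F).hom.app (op c) x)).unique
        ⟨(natTrans_naturality_app α _ c z).trans (congrArg _ hz1),
          (natTrans_naturality_app α _ c z).trans (congrArg _ hz2)⟩
        ⟨(natTrans_naturality_app α _ c z').trans (congrArg _ hz1'),
          (natTrans_naturality_app α _ c z').trans ((congrArg _ hz2').trans hx.symm)⟩
    have h3 : z = z' := congrArg Subtype.val ((hB c).1 (a₁ := ⟨z, hz1⟩) (a₂ := ⟨z', hz1'⟩)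
      (Subtype.ext h1))
    exact hz2.symm.trans ((congrArg _ h3).trans hz2')
  · intro y
    obtain ⟨z', ⟨hz1', hz2'⟩, -⟩ := hk ((α.natTrans.app A).hom.app (op c) (s.val c)) y
    obtain ⟨⟨z, hz⟩, h1⟩ := (hB c).2 ⟨z', hz1'⟩
    refine ⟨(h.inverseImage.map prod.snd).hom.app (op c) z, ?_⟩
    exact (natTrans_naturality_app α prod.snd c z).symm.trans
      ((congrArg _ (congrArg Subtype.val h1)).trans hz2')

end GeometricMorphism

theorem CategoryTheory.Over.star_map_eq {X : Type (u + 1)} [LargeCategory.{u} X]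
    [HasFiniteLimits X] (A : X) {Z : X} {a b : ⊤_ X ⟶ Z}
    (h : terminal.from A ≫ a = terminal.from A ≫ b) :
    (Over.star A).map a = (Over.star A).map b := by
  ext
  have key : ∀ c : ⊤_ X ⟶ Z, (prod.snd : A ⨯ ⊤_ X ⟶ _) ≫ c = prod.fst ≫ terminal.from A ≫ c := by
    intro c
    rw [← Category.assoc]
    congr 1
    exact Subsingleton.elim _ _
  simp only [Over.star_map_left]
  apply Limits.prod.hom_ext
  · simp
  · simp [key, h]

/-- A topos with a jointly faithful family of étale geometric morphisms from grouplike topoi is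
grouplike. -/
theorem IsGrouplike.of_isEtale {X : Type (u + 1)} [LargeCategory.{u} X] [IsGrothendieckTopos X]
    {ι : Type*} {Y : ι → Type (u + 1)} [∀ i, LargeCategory.{u} (Y i)]
    (f : ∀ i, GeometricMorphism (Y i) X) (hf : ∀ i, (f i).IsEtale)
    (hfaithful : ∀ {F G : X} (a b : F ⟶ G),
      (∀ i, (f i).inverseImage.map a = (f i).inverseImage.map b) → a = b)
    (hY : ∀ i, IsGrouplike (Y i)) : IsGrouplike X where
  isGrothendieckTopos := inferInstance
  isGroupoid E _ _ := by
    refine ⟨fun {g k} α => GeometricMorphism.isIso_of_natTrans α ?_⟩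
    choose A e hA using hf
    -- Two global elements of `Z` that agree over every `A i` have equal inverse images in every `Y
    -- i`, so joint faithfulness identifies them.
    have hcov : JointlyCovers A := by
      intro Z a b hab
      refine hfaithful a b fun i => ?_
      obtain ⟨θ⟩ := hA i
      rw [← cancel_mono (θ.hom.app Z), θ.hom.naturality, θ.hom.naturality]
      simp only [Functor.comp_map, Over.star_map_eq (A i) (hab i)]
    rw [NatTrans.isIso_iff_isIso_app]
    intro F
    refine (hcov.inverseImage g).isIso _ fun i T t => ?_
    obtain ⟨C, _, K, p, s, hp⟩ :=
      IsGrothendieckTopos.exists_globalSection (g.inverseImage.obj (A i))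
    refine hp _ ?_ t
    exact GeometricMorphism.isIso_natTrans_of_globalSection (hY i) (e i)
      ((p.precomp X).map α) s F

/-! ### Set-valued functors on a groupoid. -/

instance isGrothendieckTopos_functor (G : Type u) [SmallCategory G] :
    IsGrothendieckTopos (G ⥤ Type u) :=
  ⟨⟨Gᵒᵖ, inferInstance, ⊥,
    ⟨((opOpEquivalence G).symm.congrLeft (E := Type u)).trans (sheafBotEquivalence (Type u)).symm⟩⟩⟩

/-- If `Q` is both the product of `R` and `F` and the product of `R` and `F'`, then over an element
of `Φ R` a natural transformation between product-preserving functors which is bijective at `F'` is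
bijective at `F`. -/
theorem bijective_app_of_isLimit {X : Type (u + 1)} [LargeCategory.{u} X] {Φ Ψ : X ⥤ Type u}
    [PreservesFiniteLimits Φ] [PreservesFiniteLimits Ψ] (α : Φ ⟶ Ψ) {Q R F F' : X} {q : Q ⟶ R}
    {p : Q ⟶ F} {p' : Q ⟶ F'} (hp : IsLimit (BinaryFan.mk q p)) (hp' : IsLimit (BinaryFan.mk q p'))
    (h : Function.Bijective (α.app F')) (a : Φ.obj R) : Function.Bijective (α.app F) := by
  have nat : ∀ {V W : X} (r : V ⟶ W) (z : Φ.obj V),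
      Ψ.map r (α.app V z) = α.app W (Φ.map r z) :=
    fun r z => (NatTrans.naturality_apply α r z).symm
  constructor
  · intro x₁ x₂ hx
    obtain ⟨z₁, ⟨h₁, rfl⟩, -⟩ := existsUnique_of_isLimit_binaryFan Φ hp a x₁
    obtain ⟨z₂, ⟨h₂, rfl⟩, -⟩ := existsUnique_of_isLimit_binaryFan Φ hp a x₂
    have hz : α.app Q z₁ = α.app Q z₂ :=
      (existsUnique_of_isLimit_binaryFan Ψ hp (α.app R a) (α.app F (Φ.map p z₁))).unique
        ⟨by rw [nat, h₁], nat _ _⟩ ⟨by rw [nat, h₂], by rw [nat, hx]⟩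
    have hz' : Φ.map p' z₁ = Φ.map p' z₂ := h.1 (by rw [← nat, ← nat, hz])
    have : z₁ = z₂ :=
      (existsUnique_of_isLimit_binaryFan Φ hp' a (Φ.map p' z₁)).unique ⟨h₁, rfl⟩ ⟨h₂, hz'.symm⟩
    rw [this]
  · intro y
    obtain ⟨w, ⟨h₁, rfl⟩, -⟩ := existsUnique_of_isLimit_binaryFan Ψ hp (α.app R a) y
    obtain ⟨x', hx'⟩ := h.2 (Ψ.map p' w)
    obtain ⟨z, ⟨h₂, rfl⟩, -⟩ := existsUnique_of_isLimit_binaryFan Φ hp' a x'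
    have hz : α.app Q z = w :=
      (existsUnique_of_isLimit_binaryFan Ψ hp' (α.app R a) (Ψ.map p' w)).unique
        ⟨by rw [nat, h₂], by rw [nat, hx']⟩ ⟨h₁, rfl⟩
    exact ⟨Φ.map p z, by rw [← nat, hz]⟩

section

variable {G : Type u} [Groupoid.{u} G]

/-- The product of the functor corepresented by `x` with `F`. -/
def coyonedaProd (x : G) (F : G ⥤ Type u) : G ⥤ Type u where
  obj z := (x ⟶ z) × F.obj z
  map f := ↾fun p => (p.1 ≫ f, F.map f p.2)
  map_id z := by ext p <;> simp
  map_comp f g := by ext p <;> simp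

namespace coyonedaProd

variable (x : G) (F : G ⥤ Type u)

def fst : coyonedaProd x F ⟶ coyoneda.obj (op x) where
  app z := ↾fun p => p.1

def snd : coyonedaProd x F ⟶ F where
  app z := ↾fun p => p.2

/-- Transport to the fiber at `x`. -/
def sndConst : coyonedaProd x F ⟶ (Functor.const G).obj (F.obj x) where
  app z := ↾fun p => F.map (Groupoid.inv p.1) p.2
  naturality z w f := by
    ext p
    change F.map (Groupoid.inv (p.1 ≫ f)) (F.map f p.2) = F.map (Groupoid.inv p.1) p.2
    rw [← Functor.map_comp_apply]
    simp

def isLimit : IsLimit (BinaryFan.mk (fst x F) (snd x F)) :=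
  BinaryFan.IsLimit.mk _
    (fun {T} u v => { app := fun z => ↾fun t => (u.app z t, v.app z t)
                      naturality := fun z w f => by
                        ext t
                        have h₁ : u.app w (T.map f t) = u.app z t ≫ f :=
                          NatTrans.naturality_apply u f t
                        have h₂ : v.app w (T.map f t) = F.map f (v.app z t) :=
                          NatTrans.naturality_apply v f t
                        exact Prod.ext h₁ h₂ })
    (fun _ _ => rfl) (fun _ _ => rfl)
    (fun _ _ _ h₁ h₂ => by subst h₁ h₂; rfl)

/-- Invertibility of arrows enters here: `(u, a) ↦ (u, F(u)⁻¹ a)` trivializes `F` over the functor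
corepresented by `x`. -/
def isLimitConst : IsLimit (BinaryFan.mk (fst x F) (sndConst x F)) :=
  BinaryFan.IsLimit.mk _
    (fun {T} u v => { app := fun z => ↾fun t => (u.app z t, F.map (u.app z t) (v.app z t))
                      naturality := fun z w f => by
                        ext t
                        have h₁ : u.app w (T.map f t) = u.app z t ≫ f :=
                          NatTrans.naturality_apply u f t
                        have h₂ : v.app w (T.map f t) = v.app z t :=
                          NatTrans.naturality_apply v f t
                        refine Prod.ext h₁ ?_
                        change F.map (u.app w (T.map f t)) (v.app w (T.map f t)) =
                          F.map f (F.map (u.app z t) (v.app z t))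
                        rw [h₁, h₂, Functor.map_comp_apply] })
    (fun _ _ => rfl)
    (fun u v => by
      ext z t
      change F.map (Groupoid.inv (u.app z t)) (F.map (u.app z t) (v.app z t)) = v.app z t
      rw [← Functor.map_comp_apply]
      simp)
    (fun u v m h₁ h₂ => by
      subst h₁ h₂
      ext z t
      refine Prod.ext rfl ?_
      change (m.app z t).2 = F.map (m.app z t).1 (F.map (Groupoid.inv (m.app z t).1) (m.app z t).2)
      rw [← Functor.map_comp_apply]
      simp)

end coyonedaProd

/-- By Yoneda, each element of the terminal functor at `x` is hit by the identity of `x`. -/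
theorem jointlyCovers_coyoneda (G : Type u) [SmallCategory G] :
    JointlyCovers fun x : G => (coyoneda.obj (op x) : G ⥤ Type u) := by
  intro Z a b h
  ext x t
  have := h x
  rw [← Subsingleton.elim (coyonedaEquiv.symm t) (terminal.from (coyoneda.obj (op x)))] at this
  simpa using congrArg (fun k => k.app x (𝟙 x)) this

/-- A natural transformation between coproduct-preserving functors on sets is invertible if it is
at the point. -/
theorem isIso_app_of_isIso_app_punit {E : Type (u + 1)} [LargeCategory.{u} E] {Φ Ψ : Type u ⥤ E}
    [PreservesColimits Φ] [PreservesColimits Ψ] (α : Φ ⟶ Ψ) [IsIso (α.app PUnit)] (S : Type u) :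
    IsIso (α.app S) := by
  -- A set is the coproduct of its points.
  let c : Cocone (Discrete.functor fun _ : S => PUnit.{u + 1}) :=
    Cofan.mk S fun s => ↾fun _ => s
  have hc : IsColimit c := Cofan.IsColimit.mk _ (fun t => ↾fun s => t.inj s PUnit.unit)
    (fun t s => by ext; rfl)
    (fun t m hm => by ext s; exact congrArg (fun k => k PUnit.unit) (hm s))
  have : ∀ j, IsIso ((Functor.whiskerLeft (Discrete.functor fun _ : S => PUnit.{u + 1}) α).app j) :=
    fun j => inferInstanceAs (IsIso (α.app PUnit))
  have : IsIso (Functor.whiskerLeft (Discrete.functor fun _ : S => PUnit.{u + 1}) α) :=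
    (NatTrans.isIso_iff_isIso_app _).2 this
  let e := asIso (Functor.whiskerLeft (Discrete.functor fun _ : S => PUnit.{u + 1}) α)
  have : α.app S = ((isColimitOfPreserves Φ hc).coconePointsIsoOfNatIso
      (isColimitOfPreserves Ψ hc) e).hom := by
    apply (isColimitOfPreserves Φ hc).hom_ext
    intro j
    rw [IsColimit.comp_coconePointsIsoOfNatIso_hom]
    exact α.naturality (c.ι.app j :)
  rw [this]
  infer_instance

/-- Both inverse images and `Functor.const G` are left adjoints, so the composites preserve
coproducts; at the point the 2-cell is a map between terminal objects. -/
theorem GeometricMorphism.isIso_app_const {E : Type (u + 1)} [LargeCategory.{u} E]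
    [HasTerminal E] (G : Type u) [SmallCategory G] {f g : GeometricMorphism E (G ⥤ Type u)}
    (α : f ⟶ g) (S : Type u) : IsIso (α.natTrans.app ((Functor.const G).obj S)) := by
  have := f.adj.leftAdjoint_preservesColimits
  have := g.adj.leftAdjoint_preservesColimits
  have : PreservesColimits (Functor.const G : Type u ⥤ _) :=
    (constLimAdj (J := G) (C := Type u)).leftAdjoint_preservesColimits
  have ht : IsTerminal ((Functor.const G).obj PUnit.{u + 1}) :=
    IsTerminal.isTerminalObj (Functor.const G) _ Types.isTerminalPUnit
  have : IsIso ((Functor.whiskerLeft (Functor.const G) α.natTrans).app PUnit) :=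
    isIso_of_isTerminal (ht.isTerminalObj f.inverseImage) (ht.isTerminalObj g.inverseImage) _
  exact isIso_app_of_isIso_app_punit (Functor.whiskerLeft (Functor.const G) α.natTrans) S

theorem isGrouplike_functor (G : Type u) [Groupoid.{u} G] : IsGrouplike (G ⥤ Type u) where
  isGrothendieckTopos := inferInstance
  isGroupoid E _ _ := by
    refine ⟨fun {f g} α => GeometricMorphism.isIso_of_natTrans α ?_⟩
    rw [NatTrans.isIso_iff_isIso_app]
    intro F
    refine ((jointlyCovers_coyoneda G).inverseImage f).isIso _ fun x T t => ?_
    have := GeometricMorphism.isIso_app_const G α (F.obj x)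
    -- The functors compared are maps from `T` into `f^*` and into `g^*`; the given `t` is the
    -- required element at the corepresentable functor.
    have := bijective_app_of_isLimit
      (Functor.whiskerRight α.natTrans (coyoneda.obj (op T)))
      (coyonedaProd.isLimit x F) (coyonedaProd.isLimitConst x F)
      ((isIso_iff_bijective _).1 (inferInstanceAs (IsIso ((coyoneda.obj (op T)).map _)))) t
    exact this

end

/-! ### The disjoint union of sites. -/

namespace SigmaSite

open SheafOfTypes

variable {I : Type u} {C : I → Type u} [∀ i, SmallCategory (C i)]

/-- The disjoint union of Grothendieck topologies. -/
def topology (J : ∀ i, GrothendieckTopology (C i)) : GrothendieckTopology (Σ i, C i) where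
  sieves X := {S | (S.functorPullback (Sigma.incl X.1) : Sieve X.2) ∈ J X.1 X.2}
  top_mem' X := (J X.1).top_mem X.2
  pullback_stable' := by
    rintro ⟨i, c⟩ ⟨_, d⟩ S ⟨f⟩ hS
    exact (J i).pullback_stable f hS
  transitive' := by
    rintro ⟨i, c⟩ S hS R hR
    exact (J i).transitive hS _ fun d f hf => hR (f := Sigma.SigmaHom.mk f) hf

/-- The sieve on `⟨i, c⟩` corresponding to a sieve on `c`. -/
def sieve {X : Σ i, C i} (S : Sieve X.2) : Sieve X where
  arrows Y g := ∃ (d : C X.1) (f : d ⟶ X.2) (h : Y = ⟨X.1, d⟩),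
    S f ∧ g = eqToHom h ≫ Sigma.SigmaHom.mk f
  downward_closed := by
    rintro Y Z g ⟨d, f, rfl, hf, rfl⟩ ⟨k⟩
    exact ⟨_, k ≫ f, rfl, S.downward_closed hf k, by simp; rfl⟩

theorem sieve_mk {i : I} {c d : C i} (S : Sieve c) (f : d ⟶ c) :
    sieve (X := ⟨i, c⟩) S (Sigma.SigmaHom.mk f : (⟨i, d⟩ : Σ i, C i) ⟶ ⟨i, c⟩) ↔ S f := by
  constructor
  · rintro ⟨d', f', h, hf, hg⟩
    obtain rfl := eq_of_heq (Sigma.mk.inj h).2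
    rw [eqToHom_refl, Category.id_comp] at hg
    obtain rfl := (Sigma.incl i).map_injective hg
    exact hf
  · intro hf
    exact ⟨d, f, rfl, hf, by simp⟩

theorem sieve_mem (J : ∀ i, GrothendieckTopology (C i)) {i : I} {c : C i} {S : Sieve c}
    (hS : S ∈ J i c) : sieve (X := ⟨i, c⟩) S ∈ topology J ⟨i, c⟩ := by
  have : (sieve (X := ⟨i, c⟩) S).functorPullback (Sigma.incl i) = S := by
    ext d f
    exact sieve_mk S f
  change (sieve (X := ⟨i, c⟩) S).functorPullback (Sigma.incl i) ∈ J i c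
  rwa [this]

variable (J : ∀ i, GrothendieckTopology (C i))

def restrict (i : I) : Sheaf (topology J) (Type u) ⥤ Sheaf (J i) (Type u) where
  obj F := ⟨(Sigma.incl i).op ⋙ F.obj, by
    apply isSheaf_of_glue
    · intro c S hS a b h
      refine separated F (sieve_mem J hS) ?_
      rintro _ ⟨f⟩ hf
      exact h f ((sieve_mk S f).1 hf)
    · intro c S hS x hx
      -- An arrow in the generated sieve has an arbitrary source, so its value is pinned down by
      -- comparison, along `eqToHom`, with all its presentations in `C i`.
      have key : ∀ (Y : Σ i, C i) (g : Y ⟶ ⟨i, c⟩) (hg : sieve (X := ⟨i, c⟩) S g),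
          ∃ y : F.obj.obj (op Y), ∀ (d : C i) (f : d ⟶ c) (hf : S f) (h : (⟨i, d⟩ : Σ i, C i) = Y),
            g = eqToHom h.symm ≫ Sigma.SigmaHom.mk f → F.obj.map (eqToHom h).op y = x f hf := by
        rintro _ ⟨f⟩ hg
        refine ⟨x f ((sieve_mk S f).1 hg), fun d f' hf' h e => ?_⟩
        obtain rfl := eq_of_heq (Sigma.mk.inj h).2
        rw [eqToHom_refl, Category.id_comp] at e
        obtain rfl := (Sigma.incl i).map_injective e
        exact Functor.map_id_apply F.obj (X := op ⟨i, d⟩) _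
      choose y hy using key
      have hy' : ∀ {d : C i} (f : d ⟶ c) (hf : S f),
          y ⟨i, d⟩ (Sigma.SigmaHom.mk f) ((sieve_mk S f).2 hf) = x f hf := by
        intro d f hf
        have := hy ⟨i, d⟩ (Sigma.SigmaHom.mk f) ((sieve_mk S f).2 hf) d f hf rfl (by simp)
        simpa using this
      obtain ⟨t, ht⟩ := exists_glue F (sieve_mem J hS) (fun Y g hg => y Y g hg) (by
        rintro _ _ ⟨f⟩ ⟨g⟩ hf
        have hf' := (sieve_mk S f).1 hf
        refine (congrArg _ (hy' f hf')).trans ((hx f g hf').trans ?_)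
        exact (hy' (g ≫ f) (S.downward_closed hf' g)).symm)
      exact ⟨t, fun d f hf => (ht (Sigma.SigmaHom.mk f) ((sieve_mk S f).2 hf)).trans (hy' f hf)⟩⟩
  map m := ⟨Functor.whiskerLeft (Sigma.incl i).op m.hom⟩

instance : (Functor.pi' (restrict J)).Faithful where
  map_injective {F G} m n h := by
    apply SheafOfTypes.hom_ext
    rintro ⟨i, c⟩ x
    exact congrArg (fun k => (k i).hom.app (op c) x) h

instance : (Functor.pi' (restrict J)).Full where
  map_surjective {F G} m := by
    refine ⟨mkHom (fun X x => (m X.1).hom.app (op X.2) x) ?_, ?_⟩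
    · rintro ⟨i, c⟩ ⟨_, d⟩ ⟨f⟩ x
      exact hom_naturality (m i) f x
    · rfl

/-- The sheaf on the disjoint union given by a family of sheaves. -/
def glue (F : ∀ i, Sheaf (J i) (Type u)) : Sheaf (topology J) (Type u) :=
  ⟨(Sigma.desc fun i => (F i).obj.rightOp).leftOp, by
    apply isSheaf_of_glue
    · rintro ⟨i, c⟩ S hS a b h
      exact separated (F i) hS fun d f hf => h (Sigma.SigmaHom.mk f) hf
    · rintro ⟨i, c⟩ S hS x hx
      obtain ⟨t, ht⟩ := exists_glue (F i) hS (fun d f hf => x (Sigma.SigmaHom.mk f) hf)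
        fun d e f g hf => hx (Sigma.SigmaHom.mk f) (Sigma.SigmaHom.mk g) hf
      refine ⟨t, ?_⟩
      rintro _ ⟨f⟩ hf
      exact ht f hf⟩

instance : (Functor.pi' (restrict J)).EssSurj where
  mem_essImage F := ⟨glue J F, ⟨Pi.isoMk fun i =>
    (fullyFaithfulSheafToPresheaf (J i) (Type u)).preimageIso
      (NatIso.ofComponents (fun c => Iso.refl _) (fun f => by ext x; rfl))⟩⟩

instance : (Functor.pi' (restrict J)).IsEquivalence where

end SigmaSite

/-- Sheaves on a disjoint union of sites are families of sheaves on the summands. -/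
instance isGrothendieckTopos_pi {I : Type u} (X : I → Type (u + 1)) [∀ i, LargeCategory.{u} (X i)]
    [h : ∀ i, IsGrothendieckTopos (X i)] : IsGrothendieckTopos (∀ i, X i) where
  exists_site := by
    choose C hC J e using fun i => (h i).exists_site
    exact ⟨Σ i, C i, inferInstance, SigmaSite.topology J,
      ⟨(Equivalence.pi fun i => (e i).some).trans
        (Functor.pi' (SigmaSite.restrict J)).asEquivalence.symm⟩⟩

/-! ### The product category as a coproduct of topoi. -/

namespace PiTopos

variable {I : Type u} {X : I → Type (u + 1)} [∀ i, LargeCategory.{u} (X i)]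

theorem exists_obj (T : ∀ i, X i) (i : I) (B : X i) :
    ∃ D : ∀ i, X i, Nonempty (D i ≅ B) ∧ ∀ j, j ≠ i → D j = T j := by
  classical
  exact ⟨Function.update T i B, ⟨eqToIso (by simp)⟩, fun j hj => by simp [hj]⟩

theorem exists_hom {A B : ∀ i, X i} (i : I) (f : A i ⟶ B i)
    (h : ∀ j, j ≠ i → Nonempty (A j ⟶ B j)) : ∃ g : A ⟶ B, g i = f := by
  classical
  refine ⟨fun j => if hj : j = i then by subst hj; exact f else (h j hj).some, ?_⟩
  exact dif_pos rfl

/-- The right adjoint sends `B` to the family that is `B` at `i` and terminal elsewhere. -/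
instance (i : I) [∀ i, HasTerminal (X i)] : (Pi.eval X i).IsLeftAdjoint := by
  have (B : X i) : HasTerminal (CostructuredArrow (Pi.eval X i) B) := by
    obtain ⟨D, ⟨φ⟩, hD⟩ := exists_obj (fun j => ⊤_ (X j)) i B
    have hT : ∀ (A : ∀ i, X i) j, j ≠ i → Nonempty (Unique (A j ⟶ D j)) := fun A j hj => by
      rw [hD j hj]
      exact ⟨inferInstance⟩
    let T : CostructuredArrow (Pi.eval X i) B := CostructuredArrow.mk (Y := D) φ.hom
    have hex (Y : CostructuredArrow (Pi.eval X i) B) : Nonempty (Y ⟶ T) := by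
      obtain ⟨g, hg⟩ := exists_hom (A := Y.left) (B := D) i ((Y.hom : Y.left i ⟶ B) ≫ φ.inv)
        fun j hj => ⟨(hT _ j hj).some.default⟩
      refine ⟨CostructuredArrow.homMk g ?_⟩
      change g i ≫ φ.hom = Y.hom
      rw [hg]
      exact (Category.assoc (Y.hom : Y.left i ⟶ B) φ.inv φ.hom).trans
        ((congrArg _ φ.inv_hom_id).trans (Category.comp_id _))
    have huniq {Y : CostructuredArrow (Pi.eval X i) B} (m m' : Y ⟶ T) : m = m' := by
      apply CostructuredArrow.hom_ext
      funext j
      by_cases hj : j = i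
      · subst hj
        rw [← cancel_mono φ.hom]
        exact (CostructuredArrow.w m).trans (CostructuredArrow.w m').symm
      · have := (hT Y.left j hj).some
        exact (this.uniq _).trans (this.uniq _).symm
    exact (IsTerminal.ofUniqueHom (fun Y => (hex Y).some) fun _ _ => huniq _ _).hasTerminal
  exact isLeftAdjoint_of_costructuredArrowTerminals _

instance (i : I) [∀ i, HasFiniteLimits (X i)] : PreservesFiniteLimits (Pi.eval X i) where
  preservesFiniteLimits K _ _ := ⟨fun {F} => by
    let c : Cone F :=
      { pt := fun i => limit (F ⋙ Pi.eval X i)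
        π := { app := fun k i => limit.π (F ⋙ Pi.eval X i) k
               naturality := fun k l m => by
                funext i
                exact (limit.cone (F ⋙ Pi.eval X i)).π.naturality m } }
    have hc : IsLimit c :=
      { lift := fun s i => limit.lift (F ⋙ Pi.eval X i) ((Pi.eval X i).mapCone s)
        fac := fun s k => by
          funext i
          exact limit.lift_π ((Pi.eval X i).mapCone s) k
        uniq := fun s m w => by
          funext i
          apply limit.hom_ext
          intro k
          exact (congrFun (w k) i).trans (limit.lift_π ((Pi.eval X i).mapCone s) k).symm }
    refine preservesLimit_of_preserves_limit_cone hc ?_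
    exact limit.isLimit (F ⋙ Pi.eval X i)⟩

/-- The coproduct injections into the product category. -/
noncomputable def inj (X : I → Type (u + 1)) [∀ i, LargeCategory.{u} (X i)]
    [∀ i, HasFiniteLimits (X i)] (i : I) : GeometricMorphism (X i) (∀ i, X i) where
  inverseImage := Pi.eval X i
  directImage := (Pi.eval X i).rightAdjoint
  adj := Adjunction.ofIsLeftAdjoint _
  preservesFiniteLimits := inferInstance

theorem preservesFiniteLimits_pi' {E : Type (u + 1)} [LargeCategory.{u} E] (F : ∀ i, E ⥤ X i)
    [∀ i, PreservesFiniteLimits (F i)] : PreservesFiniteLimits (Functor.pi' F) where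
  preservesFiniteLimits K _ _ := ⟨fun {G} => ⟨fun {c} hc => ⟨
    { lift := fun s i => (isLimitOfPreserves (F i) hc).lift ((Pi.eval X i).mapCone s)
      fac := fun s k => by
        funext i
        exact (isLimitOfPreserves (F i) hc).fac ((Pi.eval X i).mapCone s) k
      uniq := fun s m w => by
        funext i
        exact (isLimitOfPreserves (F i) hc).uniq ((Pi.eval X i).mapCone s) (m i)
          fun k => congrFun (w k) i }⟩⟩⟩

/-- The geometric morphism out of the coproduct induced by a family of geometric morphisms. -/
noncomputable def desc {E : Type (u + 1)} [LargeCategory.{u} E] [HasLimits E]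
    (f : ∀ i, GeometricMorphism (X i) E) : GeometricMorphism (∀ i, X i) E where
  inverseImage := Functor.pi' fun i => (f i).inverseImage
  directImage := Adjunction.rightAdjointOfEquiv
    (G_obj := fun D => ∏ᶜ fun i => (f i).directImage.obj (D i))
    (fun A D =>
      { toFun := fun k => Pi.lift fun i => (f i).adj.homEquiv A (D i) (k i)
        invFun := fun k i => ((f i).adj.homEquiv A (D i)).symm (k ≫ Pi.π _ i)
        left_inv := fun k => by
          funext i
          refine (congrArg ((f i).adj.homEquiv A (D i)).symm (Pi.lift_π _ i)).trans ?_
          exact ((f i).adj.homEquiv A (D i)).symm_apply_apply (k i)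
        right_inv := fun k => by
          apply Pi.hom_ext
          intro i
          simp })
    (fun A' A D g k => by
      apply Pi.hom_ext
      intro i
      rw [Category.assoc]
      refine (Pi.lift_π _ i).trans (Eq.trans ?_ (congrArg (g ≫ ·)
        (Pi.lift_π (fun i => (f i).adj.homEquiv A (D i) (k i)) i)).symm)
      exact (f i).adj.homEquiv_naturality_left g (k i))
  adj := Adjunction.adjunctionOfEquivRight _ _
  preservesFiniteLimits := preservesFiniteLimits_pi' _

theorem isCoproduct_inj [∀ i, HasFiniteLimits (X i)] : GeometricMorphism.IsCoproduct (inj X) := by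
  intro E _ _
  have := IsGrothendieckTopos.hasLimits E
  have : (Functor.pi' fun i => (inj X i).precomp E).Faithful :=
    ⟨fun {f g} α β h => GeometricMorphism.Hom.ext <| by
      ext A i
      exact congrArg (fun k => (k i).natTrans.app A) h⟩
  have : (Functor.pi' fun i => (inj X i).precomp E).Full :=
    ⟨fun {f g} α => ⟨⟨{ app := fun A i => (α i).natTrans.app A
                        naturality := fun A B m => by
                          funext i
                          exact (α i).natTrans.naturality m }⟩, rfl⟩⟩
  have : (Functor.pi' fun i => (inj X i).precomp E).EssSurj :=
    ⟨fun f => ⟨desc f, ⟨Pi.isoMk fun i =>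
      ⟨⟨𝟙 (f i).inverseImage⟩, ⟨𝟙 (f i).inverseImage⟩, GeometricMorphism.Hom.ext (Category.id_comp _),
        GeometricMorphism.Hom.ext (Category.id_comp _)⟩⟩⟩⟩
  exact { }

end PiTopos

theorem IsGrothendieckTopos.hasInitial (E : Type (u + 1)) [LargeCategory.{u} E]
    [h : IsGrothendieckTopos E] : HasInitial E := by
  obtain ⟨C, _, J, ⟨e⟩⟩ := h.exists_site
  have : HasColimitsOfShape (Discrete PEmpty.{1}) (Sheaf J (Type u)) :=
    hasColimitsOfShape_of_reflective (sheafToPresheaf J (Type u))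
  exact Adjunction.hasColimitsOfShape_of_equivalence e.functor

namespace PiTopos

variable {I : Type u} {X : I → Type (u + 1)} [∀ i, LargeCategory.{u} (X i)]

/-- If `e` is terminal at `i` and initial elsewhere, with initial objects strict, then the slice
over `e` is equivalent to the `i`-th factor. -/
theorem isEquivalence_forget_eval (i : I) {e : ∀ i, X i} (hi : IsTerminal (e i))
    (he : ∀ j, j ≠ i → Nonempty (IsInitial (e j)))
    (hs : ∀ j, j ≠ i → ∀ {A : X j} (f : A ⟶ e j), IsIso f) :
    (Over.forget e ⋙ Pi.eval X i).IsEquivalence := by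
  have init (A : Over e) (j : I) (hj : j ≠ i) : Nonempty (IsInitial (A.left j)) := by
    have := hs j hj (A.hom j)
    exact ⟨(he j hj).some.ofIso (asIso (A.hom j)).symm⟩
  -- Every map lies over `e`: at `i` the target is terminal, elsewhere the source is initial.
  have comm {A B : Over e} (g : A.left ⟶ B.left) : g ≫ B.hom = A.hom := by
    funext j
    by_cases hj : j = i
    · subst hj
      exact hi.hom_ext _ _
    · exact (init A j hj).some.hom_ext _ _
  have : (Over.forget e ⋙ Pi.eval X i).Faithful := ⟨fun {A B} g k h => by
    apply Over.OverMorphism.ext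
    funext j
    by_cases hj : j = i
    · subst hj
      exact h
    · exact (init A j hj).some.hom_ext _ _⟩
  have : (Over.forget e ⋙ Pi.eval X i).Full := ⟨fun {A B} f => by
    obtain ⟨g, hg⟩ := exists_hom (A := A.left) (B := B.left) i f
      fun j hj => ⟨(init A j hj).some.to _⟩
    exact ⟨Over.homMk g (comm g), hg⟩⟩
  have : (Over.forget e ⋙ Pi.eval X i).EssSurj := ⟨fun B => by
    obtain ⟨D, ⟨φ⟩, hD⟩ := exists_obj e i B
    obtain ⟨g, -⟩ := exists_hom (A := D) (B := e) i (hi.from _) fun j hj => by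
      rw [hD j hj]
      exact ⟨𝟙 _⟩
    exact ⟨Over.mk g, ⟨φ⟩⟩⟩
  exact { }

theorem isEtale_inj [∀ i, IsGrothendieckTopos (X i)] (i : I) : (inj X i).IsEtale := by
  have hI : ∀ j, HasInitial (X j) := fun j => IsGrothendieckTopos.hasInitial (X j)
  obtain ⟨e, ⟨φ⟩, he⟩ := exists_obj (fun j => ⊥_ (X j)) i (⊤_ (X i))
  have hi : IsTerminal (e i) := terminalIsTerminal.ofIso φ.symm
  have h : (Over.forget e ⋙ Pi.eval X i).IsEquivalence := by
    refine isEquivalence_forget_eval i hi (fun j hj => ?_) fun j hj A f => ?_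
    · rw [he j hj]
      exact ⟨initialIsInitial⟩
    · let _ := CartesianMonoidalCategory.ofHasFiniteProducts (C := X j)
      obtain ⟨_⟩ := IsGrothendieckTopos.nonempty_monoidalClosed (E := X j)
      exact strict_initial ((he j hj) ▸ initialIsInitial) f
  refine ⟨e, (Over.forget e ⋙ Pi.eval X i).asEquivalence, ⟨?_⟩⟩
  -- As `e i` is terminal, multiplying by `e` changes nothing at `i`; this identifies evaluation
  -- with the inverse image of the slice.
  have : ∀ B, IsIso ((Pi.eval X i).map (prod.snd : e ⨯ B ⟶ B)) := fun B => by
    have hl := mapIsLimitOfPreservesOfIsLimit (Pi.eval X i) _ _ (prodIsProd e B)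
    exact (BinaryFan.isLimit_iff_isIso_snd hi _).1 ⟨hl⟩
  have hn {A B : ∀ i, X i} (f : A ⟶ B) : (Pi.eval X i).map ((Over.star e).map f).left ≫
      (Pi.eval X i).map (prod.snd : e ⨯ B ⟶ B) =
        (Pi.eval X i).map (prod.snd : e ⨯ A ⟶ A) ≫ (Pi.eval X i).map f := by
    exact congrArg (Pi.eval X i).map (prod.map_snd (𝟙 e) f)
  let n : Over.star e ⋙ Over.forget e ⋙ Pi.eval X i ≅ Pi.eval X i :=
    NatIso.ofComponents (fun B => @asIso _ _ _ _ _ (this B)) hn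
  exact n.symm

end PiTopos

theorem isGrouplike_pi {I : Type u} (X : I → Type (u + 1)) [∀ i, LargeCategory.{u} (X i)]
    (h : ∀ i, IsGrouplike (X i)) : IsGrouplike (∀ i, X i) := by
  have := fun i => (h i).isGrothendieckTopos
  exact IsGrouplike.of_isEtale (PiTopos.inj X) PiTopos.isEtale_inj (fun a b hab => funext hab) h

/-! ### Retracts and arbitrary coproducts. -/

/-- A topos is grouplike if it is a pseudo-retract of a grouplike topos. -/
theorem IsGrouplike.of_retract {P Q : Type (u + 1)} [LargeCategory.{u} P] [LargeCategory.{u} Q]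
    [IsGrothendieckTopos P] (hQ : IsGrouplike Q) (s : GeometricMorphism P Q)
    (r : GeometricMorphism Q P) (i : (s.comp r).inverseImage ≅ 𝟭 P) : IsGrouplike P where
  isGrothendieckTopos := inferInstance
  isGroupoid E _ _ := by
    have := hQ.isGroupoid E
    refine ⟨fun {f g} α => GeometricMorphism.isIso_of_natTrans α ?_⟩
    rw [NatTrans.isIso_iff_isIso_app]
    intro b
    let β : f.comp s ⟶ g.comp s := ⟨Functor.whiskerLeft s.inverseImage α.natTrans⟩
    have hβ : IsIso (β.natTrans.app (r.inverseImage.obj b)) := by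
      have := GeometricMorphism.isIso_natTrans β
      infer_instance
    have hβ' : IsIso (α.natTrans.app ((s.comp r).inverseImage.obj b)) := hβ
    -- By naturality, `α` at `b` is conjugate to `β` at `r^* b`.
    have : α.natTrans.app b = f.inverseImage.map (i.inv.app b) ≫
        α.natTrans.app ((s.comp r).inverseImage.obj b) ≫ g.inverseImage.map (i.hom.app b) := by
      rw [← α.natTrans.naturality, ← Functor.map_comp_assoc]
      simp
    rw [this]
    infer_instance

/-- An isomorphism of geometric morphisms from an isomorphism of inverse images. -/
def GeometricMorphism.isoMk {E F : Type (u + 1)} [LargeCategory.{u} E] [LargeCategory.{u} F]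
    {f g : GeometricMorphism E F} (e : f.inverseImage ≅ g.inverseImage) : f ≅ g :=
  ⟨⟨e.hom⟩, ⟨e.inv⟩, Hom.ext e.hom_inv_id, Hom.ext e.inv_hom_id⟩

/-- The isomorphism of inverse images underlying an isomorphism of geometric morphisms. -/
def GeometricMorphism.inverseImageIso {E F : Type (u + 1)} [LargeCategory.{u} E]
    [LargeCategory.{u} F] {f g : GeometricMorphism E F} (e : f ≅ g) :
    f.inverseImage ≅ g.inverseImage :=
  ⟨e.hom.natTrans, e.inv.natTrans, congrArg Hom.natTrans e.hom_inv_id,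
    congrArg Hom.natTrans e.inv_hom_id⟩

/-- Essential surjectivity of restriction gives `s` and `r`; full faithfulness identifies their
composite with the identity, since both restrict to `p i` on each summand. -/
theorem GeometricMorphism.IsCoproduct.exists_retract {I : Type u} {X : I → Type (u + 1)}
    [∀ i, LargeCategory.{u} (X i)] {P Q : Type (u + 1)} [LargeCategory.{u} P]
    [LargeCategory.{u} Q] [IsGrothendieckTopos P] [IsGrothendieckTopos Q]
    {p : ∀ i, GeometricMorphism (X i) P} {q : ∀ i, GeometricMorphism (X i) Q}
    (hp : IsCoproduct p) (hq : IsCoproduct q) :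
    ∃ (s : GeometricMorphism P Q) (r : GeometricMorphism Q P),
      Nonempty ((s.comp r).inverseImage ≅ 𝟭 P) := by
  have := hp Q
  have := hp P
  have := hq P
  obtain ⟨s, ⟨a⟩⟩ := (inferInstance :
    (Functor.pi' fun i => (p i).precomp Q).EssSurj).mem_essImage q
  obtain ⟨r, ⟨b⟩⟩ := (inferInstance :
    (Functor.pi' fun i => (q i).precomp P).EssSurj).mem_essImage p
  have c (i : I) : ((p i).precomp P).obj (s.comp r) ≅
      ((p i).precomp P).obj (ofEquivalence CategoryTheory.Equivalence.refl) :=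
    isoMk (Functor.isoWhiskerLeft r.inverseImage (inverseImageIso (Pi.isoApp a i)) ≪≫
      inverseImageIso (Pi.isoApp b i))
  exact ⟨s, r, ⟨inverseImageIso
    ((Functor.pi' fun i => (p i).precomp P).preimageIso (Pi.isoMk c))⟩⟩

theorem mainTheorem12 :
    -- descent along étale surjections
    (∀ (X Y : Type (u + 1)) [LargeCategory.{u} X] [LargeCategory.{u} Y]
        [IsGrothendieckTopos X] [IsGrothendieckTopos Y] (f : GeometricMorphism Y X),
        f.IsEtale → f.IsSurjection → IsGrouplike Y → IsGrouplike X) ∧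
    -- closure under coproducts: they exist, and each of them is grouplike
    (∀ (I : Type u) (X : I → Type (u + 1)) [∀ i, LargeCategory.{u} (X i)],
        (∀ i, IsGrouplike (X i)) →
        (∃ (P : Type (u + 1)) (_ : LargeCategory.{u} P) (_ : IsGrothendieckTopos P)
          (inj : ∀ i, GeometricMorphism (X i) P), GeometricMorphism.IsCoproduct inj) ∧
        (∀ (P : Type (u + 1)) [LargeCategory.{u} P] [IsGrothendieckTopos P]
          (inj : ∀ i, GeometricMorphism (X i) P), GeometricMorphism.IsCoproduct inj →
            IsGrouplike P)) ∧
    -- presheaf topoi on groupoids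
    (∀ (G : Type u) [Groupoid.{u} G], IsGrouplike (G ⥤ Type u)) := by
  refine ⟨fun X Y _ _ _ _ f hf hs hY => ?_, fun I X _ hX => ?_, fun G _ => isGrouplike_functor G⟩
  · have : f.inverseImage.Faithful := hs
    exact IsGrouplike.of_isEtale (fun _ : PUnit.{1} => f) (fun _ => hf)
      (fun a b h => f.inverseImage.map_injective (h PUnit.unit)) (fun _ => hY)
  · have := fun i => (hX i).isGrothendieckTopos
    refine ⟨⟨∀ i, X i, inferInstance, inferInstance, PiTopos.inj X, PiTopos.isCoproduct_inj⟩,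
      fun P _ _ inj hP => ?_⟩
    obtain ⟨s, r, ⟨e⟩⟩ := hP.exists_retract (PiTopos.isCoproduct_inj (X := X))
    exact (isGrouplike_pi X hX).of_retract s r e
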